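/- Words are over $\{0,1\}$ and $\preceq$ denotes the prefix relation. Let $\Sigma$ be a finite alphabet. A $\Sigma$-tree is a map $t\colon D\to\Sigma$ whose domain $\operatorname{dom}(t)=D$ is a finite prefix-closed subset of $\{0,1\}^\star$. A tree automaton is a finite deterministic bottom-up automaton over $\Sigma$: it has a finite state set $Q$, a start state $\iota\in Q$ (the value of the empty tree), a transition function $\delta\colon\Sigma\times Q\times Q\to Q$ applied to the root label and the values of the subtrees at $0$ and $1$, and a set $F\subseteq Q$; its language $L(\mathcal A)$ is the set of trees whose value lies in $F$. The convolution $\otimes(t_1,\dots,t_n)$ is the $(\Sigma\cup\{\Box\})^n$-tree with domain $\bigcup_i\operatorname{dom}(t_i)$ whose label at $u$ is the tuple of the $t_i(u)$, with the new symbol $\Box$ in place of $t_i(u)$ if $u\notin\operatorname{dom}(t_i)$. An automaton recognises an $n$-ary relation $R$ on $\Sigma$-trees if its language is $\{\otimes\bar t\mid\bar t\in R\}$. A tree-automatic presentation of a relational structure $\mathfrak A=(A;(R)_{R\in\mathcal R})$ is a tuple $(\mathcal A;(\mathcal A_R)_{R\in\mathcal R})$ of tree automata, over some finite alphabet $\Sigma$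 and the corresponding alphabets $(\Sigma\cup\{\Box\})^{\operatorname{ar}(R)}$ respectively, for which there is a bijection $\mu\colon A\to L(\mathcal A)$ such that $\mathcal A_R$ recognises $\mu(R)$ for every $R\in\mathcal R$. A presentation of an ordinal $\alpha$ is a presentation of the structure $(\alpha;\leq)$. A binary tree is a prefix-closed set $T\subseteq\{0,1\}^\star$. It is $T_{\mathrm{bin}}$-free if there is no injection $f\colon\{0,1\}^\star\to T$ with $u\preceq v\iff f(u)\preceq f(v)$ for all $u,v$. An infinite branch of $T$ is an infinite prefix-closed subset of $T$ that is linearly ordered by $\preceq$. The derivative $d(T)$ is the set of all $u\in T$ that lie in at least two distinct infinite branches of $T$, and $\operatorname{CB}_*(T)$ is the least $n\in\mathbb N$ such that the $n$-fold derivative $d^{(n)}(T)$ is finite. A presentation $(\mathcal A;(\mathcal A_R)_{R})$ is $T_{\mathrm{bin}}$-free if the binary tree $T(L(\mathcal A))=\bigcup_{t\in L(\mathcal A)}\operatorname{dom}(t)$ is $T_{\mathrm{bin}}$-free, and its rank is then $\operatorname{CB}_*(T(L(\mathcal A)))$ (which exists, since this tree is regular and $T_{\mathrm{bin}}$-free).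 Corollary. Let $\alpha$ be an ordinal and $k\in\mathbb N$ (including $k=0$). Then $\alpha$ admits a $T_{\mathrm{bin}}$-free tree-automatic presentation of rank at most $k$ if and only if $\alpha<\omega^{\omega^k}$. -/

import Mathlib

universe u

namespace TreeAut

/-! ### Labelled trees

Finite binary words are lists of Booleans (`false` is the digit 0, `true` is the digit 1) and
`u <+: v` is the prefix relation. A tree over the alphabet `S`, that is, a map `t : D → S` on a
finite prefix-closed set `D` of binary words, is an element of `BinaryTree S`: the empty tree is
`nil`, and `node a l r` has label `a` at the root, `l` as its subtree at 0 and `r` as its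
subtree at 1. The facts `finite_dom`, `mem_dom_of_prefix`, `label_injective` and
`exists_label_eq` below show that these are exactly the finite labelled tree domains. -/

/-- The label of the tree at the node `u`, or `none` if `u` is not in its domain. -/
def label {S : Type*} : BinaryTree S → List Bool → Option S
  | .nil, _ => none
  | .node a _ _, [] => some a
  | .node _ l _, false :: u => label l u
  | .node _ _ r, true :: u => label r u

/-- The domain of a tree. -/
def dom {S : Type*} (t : BinaryTree S) : Set (List Bool) :=
  {u | label t u ≠ none}

/-- The label at the root. -/
def root {S : Type*} : BinaryTree S → Option S
  | .nil => none
  | .node a _ _ => some a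

theorem label_nil_word {S : Type*} (t : BinaryTree S) : label t [] = root t := by
  cases t <;> rfl

theorem label_cons_false {S : Type*} (t : BinaryTree S) (u : List Bool) :
    label t (false :: u) = label t.left u := by
  cases t <;> simp [label, BinaryTree.left]

theorem label_cons_true {S : Type*} (t : BinaryTree S) (u : List Bool) :
    label t (true :: u) = label t.right u := by
  cases t <;> simp [label, BinaryTree.right]

theorem mem_dom_of_prefix {S : Type*} (t : BinaryTree S) {u v : List Bool} (h : u <+: v)
    (hv : v ∈ dom t) : u ∈ dom t := by
  induction t generalizing u v with
  | nil => simp [dom, label] at hv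
  | node a l r hl hr =>
    rcases u with _ | ⟨b, u⟩
    · simp [dom, label]
    · rcases v with _ | ⟨c, v⟩
      · simp at h
      · obtain ⟨rfl, huv⟩ := List.cons_prefix_cons.1 h
        cases b
        · exact hl huv hv
        · exact hr huv hv

theorem finite_dom {S : Type*} (t : BinaryTree S) : (dom t).Finite := by
  induction t with
  | nil => simp [dom, label]
  | node a l r hl hr =>
    refine (((hl.image (List.cons false)).union (hr.image (List.cons true))).insert []).subset ?_
    rintro (_ | ⟨_ | _, u⟩) hu
    · simp
    · exact Or.inr (Or.inl ⟨u, hu, rfl⟩)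
    · exact Or.inr (Or.inr ⟨u, hu, rfl⟩)

theorem label_injective {S : Type*} :
    Function.Injective (label : BinaryTree S → List Bool → Option S) := by
  intro s t h
  induction s generalizing t with
  | nil =>
    cases t with
    | nil => rfl
    | node b l' r' => simpa [label] using congrFun h []
  | node a l r hl hr =>
    cases t with
    | nil => simpa [label] using congrFun h []
    | node b l' r' =>
      have h0 : a = b := by simpa [label] using congrFun h []
      rw [h0, hl (funext fun u => congrFun h (false :: u)),
        hr (funext fun u => congrFun h (true :: u))]

theorem exists_label_eq {S : Type*} (f : List Bool → Option S)
    (hfin : {u | f u ≠ none}.Finite)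
    (hpre : ∀ u v : List Bool, u <+: v → f v ≠ none → f u ≠ none) :
    ∃ t : BinaryTree S, label t = f := by
  obtain ⟨n, hn⟩ : ∃ n, ∀ u, f u ≠ none → u.length < n := by
    obtain ⟨n, hn⟩ := (hfin.image List.length).bddAbove
    exact ⟨n + 1, fun u hu => Nat.lt_succ_of_le (hn ⟨u, hu, rfl⟩)⟩
  clear hfin
  induction n generalizing f with
  | zero =>
    refine ⟨.nil, funext fun u => ?_⟩
    by_contra h
    exact absurd (hn u fun h' => h (by simp [label, h'])) (by simp)
  | succ n ih =>
    cases h0 : f [] with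
    | none =>
      refine ⟨.nil, funext fun u => ?_⟩
      by_contra h
      exact hpre [] u List.nil_prefix (fun h' => h (by simp [label, h'])) h0
    | some a =>
      have key (b : Bool) : ∃ t : BinaryTree S, label t = fun u => f (b :: u) :=
        ih _ (fun u v huv => hpre _ _ (List.cons_prefix_cons.2 ⟨rfl, huv⟩))
          fun u hu => by simpa using hn _ hu
      obtain ⟨l, hl⟩ := key false
      obtain ⟨r, hr⟩ := key true
      refine ⟨.node a l r, funext ?_⟩
      rintro (_ | ⟨_ | _, u⟩)
      · simp [label, h0]
      · simp [label, hl]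
      · simp [label, hr]

/-! ### Tree automata -/

/-- A deterministic bottom-up tree automaton over the alphabet `S`. -/
structure TreeAutomaton (S : Type) where
  /-- The set of states. -/
  State : Type
  finite_state : Finite State
  /-- The start state. -/
  start : State
  /-- The transition function. -/
  step : S → State → State → State
  /-- The set of accepting states. -/
  accept : Set State

namespace TreeAutomaton

/-- The state reached at the root of a tree. -/
def eval {S : Type} (A : TreeAutomaton S) : BinaryTree S → A.State
  | .nil => A.start
  | .node a l r => A.step a (A.eval l) (A.eval r)

/-- The tree language recognised by the automaton. -/
def language {S : Type} (A : TreeAutomaton S) : Set (BinaryTree S) :=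
  {t | A.eval t ∈ A.accept}

end TreeAutomaton

open Classical in
/-- The convolution of an `n`-tuple of trees. The padding symbol is `none`. -/
noncomputable def conv {S : Type} {n : ℕ} (t : Fin n → BinaryTree S) :
    BinaryTree (Fin n → Option S) :=
  if _h : ∀ i, t i = .nil then .nil
  else .node (fun i => root (t i)) (conv fun i => (t i).left) (conv fun i => (t i).right)
termination_by ∑ i, (t i).numNodes
decreasing_by
  all_goals
    obtain ⟨i, hi⟩ := not_forall.1 _h
    refine Finset.sum_lt_sum (fun j _ => ?_) ⟨i, Finset.mem_univ i, ?_⟩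
    · cases t j
      · simp [BinaryTree.left, BinaryTree.right]
      · simp [BinaryTree.left, BinaryTree.right]
        omega
    · cases h : t i
      · exact absurd h hi
      · simp [BinaryTree.left, BinaryTree.right]

open Classical in
/-- The domain of the convolution is the union of the domains, and its label at `u` is the tuple
of the labels at `u`, padded by `none`. -/
theorem label_conv {S : Type} {n : ℕ} (t : Fin n → BinaryTree S) (u : List Bool) :
    label (conv t) u =
      if ∀ i, label (t i) u = none then none else some fun i => label (t i) u := by
  induction u generalizing t with
  | nil =>
    rw [conv]
    have : (∀ i, t i = .nil) ↔ ∀ i, label (t i) [] = none :=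
      forall_congr' fun i => by cases t i <;> simp [label]
    by_cases h : ∀ i, t i = .nil
    · rw [dif_pos h, if_pos (this.1 h)]; rfl
    · rw [dif_neg h, if_neg (mt this.2 h)]
      simp [label, label_nil_word]
  | cons b u ih =>
    rw [conv]
    by_cases h : ∀ i, t i = .nil
    · simp [h, label]
    · rw [dif_neg h]
      cases b
      · simp only [label, ih, label_cons_false]
      · simp only [label, ih, label_cons_true]

/-- The automaton `B` recognises the `n`-ary relation `R` on trees, that is, it recognises the
language of all convolutions of tuples in `R`. -/
def Recognises {S : Type} {n : ℕ} (B : TreeAutomaton (Fin n → Option S))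
    (R : Set (Fin n → BinaryTree S)) : Prop :=
  B.language = conv '' R

/-! ### Tree-automatic presentations -/

/-- A tuple of tree automata over the alphabet `S`: one for the universe, and one for each
relation symbol of the signature `L`. -/
structure Presentation (L : FirstOrder.Language) (S : Type) where
  univ : TreeAutomaton S
  rel : ∀ {n : ℕ}, L.Relations n → TreeAutomaton (Fin n → Option S)

/-- `P` is a tree-automatic presentation of the relational structure `M`: there is a bijective
naming function from `M` onto the language of the first automaton such that the automaton of each
relation symbol recognises the image of the corresponding relation. -/
def Presentation.Presents {L : FirstOrder.Language} [L.IsRelational] {S : Type}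
    (P : Presentation L S) (M : Type u) [L.Structure M] : Prop :=
  ∃ μ : M → BinaryTree S, Set.BijOn μ Set.univ P.univ.language ∧
    ∀ (n : ℕ) (R : L.Relations n),
      Recognises (P.rel R)
        ((fun (x : Fin n → M) (i : Fin n) => μ (x i)) ''
          {x | FirstOrder.Language.Structure.RelMap R x})

/-- An ordinal `α` as the structure `(α; ≤)`. -/
noncomputable instance ordinalStructure (α : Ordinal.{u}) : FirstOrder.Language.order.Structure α.ToType :=
  FirstOrder.Language.orderStructure α.ToType

/-! ### Binary trees and the Cantor-Bendixson rank

A binary tree is a prefix-closed set of binary words. -/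

/-- A set of binary words is closed under prefixes. -/
def PrefixClosed (T : Set (List Bool)) : Prop :=
  ∀ u v : List Bool, u <+: v → v ∈ T → u ∈ T

/-- The infinite full binary tree cannot be embedded into `T`. -/
def TbinFree (T : Set (List Bool)) : Prop :=
  ¬ ∃ f : List Bool → List Bool, Function.Injective f ∧ (∀ u, f u ∈ T) ∧
    ∀ u v : List Bool, u <+: v ↔ f u <+: f v

/-- `P` is an infinite branch of `T`. -/
def IsInfiniteBranch (T P : Set (List Bool)) : Prop :=
  P ⊆ T ∧ P.Infinite ∧ PrefixClosed P ∧ ∀ u ∈ P, ∀ v ∈ P, u <+: v ∨ v <+: u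

/-- The derivative of `T`: the nodes contained in at least two distinct infinite branches. -/
def derivative (T : Set (List Bool)) : Set (List Bool) :=
  {u ∈ T | ∃ P Q : Set (List Bool), P ≠ Q ∧ IsInfiniteBranch T P ∧ IsInfiniteBranch T Q ∧
    u ∈ P ∧ u ∈ Q}

/-- The rank of `T`: the least `n` such that the `n`-th derivative of `T` is finite (and `⊤` if
there is no such `n`). -/
noncomputable def cbRank (T : Set (List Bool)) : ℕ∞ :=
  sInf ((fun n : ℕ => (n : ℕ∞)) '' {n : ℕ | (derivative^[n] T).Finite})

/-- The binary tree of a tree language: the union of the domains of its trees. -/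
def treeOf {S : Type} (K : Set (BinaryTree S)) : Set (List Bool) :=
  ⋃ t ∈ K, dom t

/-- The presentation is free of the infinite full binary tree. -/
def Presentation.IsTbinFree {L : FirstOrder.Language} {S : Type} (P : Presentation L S) : Prop :=
  TbinFree (treeOf P.univ.language)

/-- The rank of a presentation. -/
noncomputable def Presentation.rank {L : FirstOrder.Language} {S : Type}
    (P : Presentation L S) : ℕ∞ :=
  cbRank (treeOf P.univ.language)

end TreeAut

/-! The upper bound is a box decomposition run along the Cantor–Bendixson rank. Order types are
measured by degree: a set has degree at most `γ` if it embeds into an ordinal below `ω ^ (γ + 1)`.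
Finite unions do not raise a degree bound (`WOn.degLT_union`). If an order on a product induces on
each slice an order that does not depend on the other coordinate, then the degree is at most the
Hessenberg sum of the two degrees (`degLT_prod`).

The claim `DiagBound E j`, proved by induction on `j`, is that well-orders on diagonal sets of trees
inside `T` have degree below `ω ^ j` when `j` derivatives make `T` finite. For `j = 0` only finitely
many trees fit into `T`. For the step, the trees below `p` are sorted by the state reached on their
pair with `p`. Descending into `p`, each fibre is, up to the empty tree, a finite union of products
of fibres over the two subtrees of `p` (`degLT_fiberSet`); over an empty subtree of `p` it is a
whole diagonal set or empty. The `c` infinite branches of the `j`-th derivative of `T` are shared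
out among these end positions. A position receiving none has degree below `ω ^ j` by induction. For
the others, as there are finitely many states, one `N` serves for all diagonal sets of degree below
`ω ^ (j + 1)`: their degree is at most `ω ^ j * N`.

The sum yields a gap: an initial segment of degree below `ω ^ (j + 1)` already has degree below a
fixed `G < ω ^ (j + 1)`. Transfinite induction along the order cannot jump over this gap
(`DiagBound.succ`).

Conversely, unlabelled trees with at most `k` left turns on every path, compared at the right
subtree first, are well-ordered like `ω ^ ω ^ k`, by expansion in base `ω ^ ω ^ (k - 1)` for `k >
0`. Each `α` below this is the set of trees preceding some `p`. Finitely many data per tree decide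
membership and order. Preceding `p` bounds the rightmost path, so the domains lie in a `combTree`,
whose `k`-th derivative is finite. -/

namespace TreeAut

open Ordinal Set

/-! ### The Hessenberg sum of ordinals -/

/-- The Hessenberg (natural) sum of two ordinals. -/
noncomputable def hsum (a b : Ordinal.{u}) : Ordinal.{u} :=
  max (⨆ x : Iio a, Order.succ (hsum x.1 b)) (⨆ x : Iio b, Order.succ (hsum a x.1))
termination_by (a, b)
decreasing_by all_goals cases x; decreasing_tactic

theorem hsum_le_iff {a b c : Ordinal.{u}} :
    hsum a b ≤ c ↔ (∀ x < a, hsum x b < c) ∧ ∀ y < b, hsum a y < c := by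
  rw [hsum]
  simp [Ordinal.iSup_le_iff]

theorem hsum_lt_hsum_left {b c : Ordinal.{u}} (h : b < c) (a : Ordinal.{u}) :
    hsum a b < hsum a c :=
  (hsum_le_iff.1 le_rfl).2 b h

theorem hsum_lt_hsum_right {a b : Ordinal.{u}} (h : a < b) (c : Ordinal.{u}) :
    hsum a c < hsum b c :=
  (hsum_le_iff.1 le_rfl).1 a h

theorem hsum_le_hsum {a b c d : Ordinal.{u}} (h : a ≤ b) (h' : c ≤ d) :
    hsum a c ≤ hsum b d := by
  have h1 : hsum a c ≤ hsum b c := by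
    rcases h.eq_or_lt with rfl | h
    exacts [le_rfl, (hsum_lt_hsum_right h c).le]
  have h2 : hsum b c ≤ hsum b d := by
    rcases h'.eq_or_lt with rfl | h'
    exacts [le_rfl, (hsum_lt_hsum_left h' b).le]
  exact h1.trans h2

theorem hsum_zero_zero : hsum (0 : Ordinal.{u}) 0 = 0 := by
  rw [← nonpos_iff_eq_zero, hsum_le_iff]
  simp

/-- Division with remainder by `ω ^ e`. The final disjunction is the lexicographic decrease that
drives the induction in `hsum_add_le`. -/
theorem lt_opow_mul_add {e r x : Ordinal.{u}} {n : ℕ} (hr : r < ω ^ e)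
    (hx : x < ω ^ e * n + r) :
    ∃ (n' : ℕ) (r' : Ordinal.{u}), r' < ω ^ e ∧ x = ω ^ e * n' + r' ∧
      (n' < n ∨ n' = n ∧ r' < r) := by
  have h0 : (ω : Ordinal.{u}) ^ e ≠ 0 := opow_ne_zero _ omega0_ne_zero
  have hx' : x < ω ^ e * (n + 1) := by
    refine hx.trans ?_
    rw [mul_add_one]
    gcongr
  have hq : x / ω ^ e < n + 1 := (lt_mul_iff_div_lt h0).1 hx'
  obtain ⟨m, hm⟩ := lt_omega0.1 (hq.trans (by exact_mod_cast natCast_lt_omega0 (n + 1)))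
  have hdm : ω ^ e * m + x % ω ^ e = x := by
    rw [← hm]; exact div_add_mod x _
  refine ⟨m, x % ω ^ e, mod_lt _ h0, hdm.symm, ?_⟩
  rw [hm] at hq
  have hmn : m < n + 1 := by exact_mod_cast hq
  rcases Nat.lt_succ_iff_lt_or_eq.1 hmn with h | rfl
  · exact Or.inl h
  · refine Or.inr ⟨rfl, ?_⟩
    rw [← hdm] at hx
    exact lt_of_add_lt_add_left hx

/-- Nested lexicographic induction on the two pairs of coefficient and remainder. When a coefficient
drops, `he` keeps the sum of the remainders below the lost copy of `ω ^ e`. -/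
theorem hsum_add_le {e : Ordinal.{u}}
    (he : ∀ a b : Ordinal.{u}, a < ω ^ e → b < ω ^ e → hsum a b < ω ^ e) (n m : ℕ)
    {r s : Ordinal.{u}} (hr : r < ω ^ e) (hs : s < ω ^ e) :
    hsum (ω ^ e * n + r) (ω ^ e * m + s) ≤ ω ^ e * (n + m : ℕ) + hsum r s := by
  have key : ∀ {k l : ℕ} {t t' : Ordinal.{u}}, t < ω ^ e → k < l →
      ω ^ e * k + t < ω ^ e * l + t' := by
    intro k l t t' ht hkl
    calc ω ^ e * k + t < ω ^ e * k + ω ^ e := by gcongr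
      _ = ω ^ e * (k + 1 : ℕ) := by push_cast; rw [mul_add_one]
      _ ≤ ω ^ e * l := by gcongr; exact_mod_cast hkl
      _ ≤ _ := le_self_add
  induction hp : (toLex (n, r) : ℕ ×ₗ Ordinal.{u}) using WellFoundedLT.induction
    generalizing n r m s with
  | ind p ih =>
    subst hp
    induction hp : (toLex (m, s) : ℕ ×ₗ Ordinal.{u}) using WellFoundedLT.induction
      generalizing m s with
    | ind p ih' =>
      subst hp
      rw [hsum_le_iff]
      constructor
      · intro x hx
        obtain ⟨n', r', hr', rfl, h⟩ := lt_opow_mul_add hr hx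
        refine (ih (toLex (n', r')) ?_ n' m hr' hs rfl).trans_lt ?_
        · rw [Prod.Lex.toLex_lt_toLex]; exact h
        · rcases h with h | ⟨rfl, h⟩
          · exact key (he _ _ hr' hs) (by omega)
          · gcongr
            exact hsum_lt_hsum_right h s
      · intro x hx
        obtain ⟨m', s', hs', rfl, h⟩ := lt_opow_mul_add hs hx
        refine (ih' (toLex (m', s')) ?_ m' hs' rfl).trans_lt ?_
        · rw [Prod.Lex.toLex_lt_toLex]; exact h
        · rcases h with h | ⟨rfl, h⟩
          · exact key (he _ _ hr hs') (by omega)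
          · gcongr
            exact hsum_lt_hsum_left h r

theorem exists_eq_opow_mul_add {e a : Ordinal.{u}} (he : e ≠ 0) (ha : a < ω ^ e) :
    ∃ c < e, ∀ c', c ≤ c' → c' < e → ∃ (n : ℕ) (r : Ordinal.{u}), r < ω ^ c' ∧
      a = ω ^ c' * n + r := by
  obtain ⟨c, hc, n, hn⟩ := (lt_omega0_opow he).1 ha
  refine ⟨c, hc, fun c' hcc' _ => ?_⟩
  have h : a < ω ^ c' * n + 0 := by
    rw [add_zero]
    refine hn.trans_le ?_
    gcongr
    exact omega0_pos
  obtain ⟨m, r, hr, h1, -⟩ := lt_opow_mul_add (opow_pos _ omega0_pos) h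
  exact ⟨m, r, hr, h1⟩

/-- Both arguments can be expanded at one common exponent below `e`, where `hsum_add_le` adds the
coefficients. -/
theorem hsum_lt_opow (e : Ordinal.{u}) {a b : Ordinal.{u}} (ha : a < ω ^ e) (hb : b < ω ^ e) :
    hsum a b < ω ^ e := by
  induction e using WellFoundedLT.induction generalizing a b with
  | ind e ih =>
    rcases eq_or_ne e 0 with rfl | he
    · rw [opow_zero, Order.lt_one_iff] at *
      rw [ha, hb, hsum_zero_zero]
    · obtain ⟨c, hc, h1⟩ := exists_eq_opow_mul_add he ha
      obtain ⟨d, hd, h2⟩ := exists_eq_opow_mul_add he hb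
      obtain ⟨n, r, hr, rfl⟩ := h1 (max c d) (le_max_left _ _) (max_lt hc hd)
      obtain ⟨m, s, hs, rfl⟩ := h2 (max c d) (le_max_right _ _) (max_lt hc hd)
      have ih' := fun a b => @ih (max c d) (max_lt hc hd) a b
      refine (hsum_add_le ih' n m hr hs).trans_lt ?_
      calc ω ^ max c d * (n + m : ℕ) + hsum r s
          < ω ^ max c d * (n + m : ℕ) + ω ^ max c d := by gcongr; exact ih' _ _ hr hs
        _ = ω ^ max c d * (n + m + 1 : ℕ) := by push_cast; rw [mul_add_one]
        _ < ω ^ e := opow_mul_lt_opow (natCast_lt_omega0 _) (max_lt hc hd)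

/-! ### Sets of elements embedding into an ordinal -/

/-- The set `X`, ordered by `r`, has a strictly monotone map to the ordinal `β`. -/
def Embeds {A : Type*} (r : A → A → Prop) (X : Set A) (β : Ordinal.{u}) : Prop :=
  ∃ f : A → Ordinal.{u}, ∀ x ∈ X, f x < β ∧ ∀ y ∈ X, r x y → f x < f y

/-- The relation `r` is a strict well-order on `X`, whose order type is an ordinal in the
universe `u`. -/
def WOn {A : Type*} (r : A → A → Prop) (X : Set A) : Prop :=
  (∀ x ∈ X, ∀ y ∈ X, x ≠ y → r x y ∨ r y x) ∧ ∃ β : Ordinal.{u}, Embeds r X β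

/-- The set `X`, ordered by `r`, embeds into an ordinal below `ω ^ γ`. -/
def DegLT {A : Type*} (r : A → A → Prop) (X : Set A) (γ : Ordinal.{u}) : Prop :=
  ∃ β < ω ^ γ, Embeds r X β

section

variable {A : Type*} {r : A → A → Prop} {X Y : Set A}

theorem Embeds.mono {β β' : Ordinal.{u}} (h : Embeds r X β) (hYX : Y ⊆ X) (hβ : β ≤ β') :
    Embeds r Y β' := by
  obtain ⟨f, hf⟩ := h
  exact ⟨f, fun x hx => ⟨(hf x (hYX hx)).1.trans_le hβ, fun y hy => (hf x (hYX hx)).2 y (hYX hy)⟩⟩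

theorem Embeds.comap {B : Type*} {s : B → B → Prop} {Z : Set B} {β : Ordinal.{u}}
    (h : Embeds r X β) (g : B → A) (hg : ∀ z ∈ Z, g z ∈ X)
    (hr : ∀ z ∈ Z, ∀ w ∈ Z, s z w → r (g z) (g w)) : Embeds s Z β := by
  obtain ⟨f, hf⟩ := h
  exact ⟨f ∘ g, fun x hx => ⟨(hf _ (hg x hx)).1,
    fun y hy hxy => (hf _ (hg x hx)).2 _ (hg y hy) (hr x hx y hy hxy)⟩⟩

theorem DegLT.mono {γ γ' : Ordinal.{u}} (h : DegLT r X γ) (hYX : Y ⊆ X) (hγ : γ ≤ γ') :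
    DegLT r Y γ' := by
  obtain ⟨β, hβ, h⟩ := h
  exact ⟨β, hβ.trans_le (opow_le_opow_right omega0_pos hγ), h.mono hYX le_rfl⟩

theorem DegLT.comap {B : Type*} {s : B → B → Prop} {Z : Set B} {γ : Ordinal.{u}}
    (h : DegLT r X γ) (g : B → A) (hg : ∀ z ∈ Z, g z ∈ X)
    (hr : ∀ z ∈ Z, ∀ w ∈ Z, s z w → r (g z) (g w)) : DegLT s Z γ := by
  obtain ⟨β, hβ, h⟩ := h
  exact ⟨β, hβ, h.comap g hg hr⟩

theorem degLT_empty (γ : Ordinal.{u}) : DegLT r ∅ γ :=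
  ⟨0, opow_pos _ omega0_pos, fun _ => 0, by simp⟩

theorem WOn.mono (h : WOn.{u} r X) (hYX : Y ⊆ X) : WOn.{u} r Y := by
  obtain ⟨h1, β, h2⟩ := h
  exact ⟨fun x hx y hy => h1 x (hYX hx) y (hYX hy), β, h2.mono hYX le_rfl⟩

theorem WOn.comap {B : Type*} {s : B → B → Prop} {Z : Set B} (h : WOn.{u} r X) (g : B → A)
    (hinj : Function.Injective g) (hg : ∀ z ∈ Z, g z ∈ X)
    (hr : ∀ z ∈ Z, ∀ w ∈ Z, s z w ↔ r (g z) (g w)) : WOn.{u} s Z := by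
  obtain ⟨h1, β, h2⟩ := h
  refine ⟨fun x hx y hy hxy => ?_, β, h2.comap g hg fun z hz w hw => (hr z hz w hw).1⟩
  rw [hr x hx y hy, hr y hy x hx]
  exact h1 _ (hg x hx) _ (hg y hy) (hinj.ne hxy)

theorem WOn.asymm (h : WOn.{u} r X) {x y : A} (hx : x ∈ X) (hy : y ∈ X) (hxy : r x y) :
    ¬ r y x := by
  obtain ⟨-, β, f, hf⟩ := h
  exact fun hyx => lt_asymm ((hf x hx).2 y hy hxy) ((hf y hy).2 x hx hyx)

theorem WOn.trans (h : WOn.{u} r X) {x y z : A} (hx : x ∈ X) (hy : y ∈ X) (hz : z ∈ X)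
    (hxy : r x y) (hyz : r y z) : r x z := by
  have h' := h
  obtain ⟨h1, β, f, hf⟩ := h
  have hlt : f x < f z := ((hf x hx).2 y hy hxy).trans ((hf y hy).2 z hz hyz)
  rcases h1 x hx z hz (by rintro rfl; exact lt_irrefl _ hlt) with h | h
  · exact h
  · exact absurd ((hf z hz).2 x hx h) hlt.not_gt

/-- Each ranking extends to a weakly monotone function on the union that increases strictly after
points of its own set. The Hessenberg sum is strictly monotone in both arguments, so it combines the
two into one strict ranking. -/
theorem WOn.embeds_union (h : WOn.{u} r (X ∪ Y)) {a b : Ordinal.{u}} (hX : Embeds r X a)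
    (hY : Embeds r Y b) : Embeds r (X ∪ Y) (hsum a b) := by
  have aux : ∀ {Z : Set A} {c : Ordinal.{u}}, Z ⊆ X ∪ Y → Embeds r Z c →
      ∃ f : A → Ordinal.{u}, (∀ x ∈ X ∪ Y, f x ≤ c ∧ ∀ y ∈ X ∪ Y, r x y → f x ≤ f y) ∧
        ∀ x ∈ Z, f x < c ∧ ∀ y ∈ X ∪ Y, r x y → f x < f y := by
    rintro Z c hZ ⟨f, hf⟩
    -- A point gets the least ordinal above the ranks of its predecessors in `Z`, which makes sense
    -- outside `Z` too.
    let s : A → Set Ordinal.{u} := fun x => {o | ∀ y ∈ Z, r y x → f y < o}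
    have hne : ∀ x, c ∈ s x := fun x y hy _ => (hf y hy).1
    have hmem : ∀ x, sInf (s x) ∈ s x := fun x => csInf_mem ⟨c, hne x⟩
    have hle : ∀ x ∈ Z, sInf (s x) ≤ f x := fun x hx =>
      csInf_le' fun y hy hyx => (hf y hy).2 x hx hyx
    refine ⟨fun x => sInf (s x), fun x hx => ⟨csInf_le' (hne x), fun y hy hxy => ?_⟩,
      fun x hx => ⟨(hle x hx).trans_lt (hf x hx).1, fun y hy hxy => ?_⟩⟩
    · exact csInf_le' fun z hz hzx => hmem y z hz (h.trans (hZ hz) hx hy hzx hxy)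
    · exact (hle x hx).trans_lt (hmem y x hx hxy)
  obtain ⟨f, hf, hf'⟩ := aux subset_union_left hX
  obtain ⟨g, hg, hg'⟩ := aux subset_union_right hY
  refine ⟨fun x => hsum (f x) (g x), fun x hx => ?_⟩
  rcases hx with hx | hx
  · refine ⟨?_, fun y hy hxy => ?_⟩
    · exact (hsum_le_hsum le_rfl (hg x (Or.inl hx)).1).trans_lt (hsum_lt_hsum_right (hf' x hx).1 _)
    · exact (hsum_le_hsum le_rfl ((hg x (Or.inl hx)).2 y hy hxy)).trans_lt
        (hsum_lt_hsum_right ((hf' x hx).2 y hy hxy) _)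
  · refine ⟨?_, fun y hy hxy => ?_⟩
    · exact (hsum_le_hsum (hf x (Or.inr hx)).1 le_rfl).trans_lt (hsum_lt_hsum_left (hg' x hx).1 _)
    · exact (hsum_le_hsum ((hf x (Or.inr hx)).2 y hy hxy) le_rfl).trans_lt
        (hsum_lt_hsum_left ((hg' x hx).2 y hy hxy) _)

theorem WOn.degLT_union (h : WOn.{u} r (X ∪ Y)) {γ : Ordinal.{u}} (hX : DegLT r X γ)
    (hY : DegLT r Y γ) : DegLT r (X ∪ Y) γ := by
  obtain ⟨a, ha, hX⟩ := hX
  obtain ⟨b, hb, hY⟩ := hY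
  exact ⟨_, hsum_lt_opow γ ha hb, h.embeds_union hX hY⟩

theorem WOn.degLT_of_subset_iUnion {ι : Type*} [Finite ι] {Z : ι → Set A} (h : WOn.{u} r X)
    (hXZ : X ⊆ ⋃ i, Z i) {γ : Ordinal.{u}} (hZ : ∀ i, DegLT r (Z i ∩ X) γ) : DegLT r X γ := by
  have key : ∀ s : Set ι, s.Finite → DegLT r (⋃ i ∈ s, Z i ∩ X) γ := by
    intro s hs
    induction s, hs using Set.Finite.induction_on with
    | empty => simpa using degLT_empty γ
    | @insert i s _ _ ih =>
      rw [biUnion_insert]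
      refine WOn.degLT_union (h.mono ?_) (hZ i) ih
      exact union_subset inter_subset_right (iUnion₂_subset fun _ _ => inter_subset_right)
  refine (key univ finite_univ).mono (fun x hx => ?_) le_rfl
  obtain ⟨i, hi⟩ := mem_iUnion.1 (hXZ hx)
  exact mem_iUnion₂.2 ⟨i, mem_univ i, hi, hx⟩

/-- Cut `ω ^ c * n` into `n` blocks of length `ω ^ c`: the quotient of a rank names the block, the
remainder embeds it. -/
theorem DegLT.exists_cover {γ : Ordinal.{u}} (h : DegLT r X γ) :
    ∃ (n : ℕ) (Z : Fin n → Set A), X ⊆ ⋃ i, Z i ∧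
      ∀ i, Z i ⊆ X ∧ ∃ γ' < γ, Embeds r (Z i) (ω ^ γ') := by
  obtain ⟨β, hβ, f, hf⟩ := h
  rcases eq_or_ne γ 0 with rfl | hγ
  · rw [opow_zero, Order.lt_one_iff] at hβ
    subst hβ
    refine ⟨0, Fin.elim0, fun x hx => ?_, fun i => i.elim0⟩
    exact absurd (hf x hx).1 not_lt_zero
  · obtain ⟨c, hc, n, hn⟩ := (lt_omega0_opow hγ).1 hβ
    have h0 : (ω : Ordinal.{u}) ^ c ≠ 0 := opow_ne_zero _ omega0_ne_zero
    refine ⟨n, fun i => {x ∈ X | f x / ω ^ c = (i : ℕ)}, fun x hx => ?_,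
      fun i => ⟨fun x hx => hx.1, c, hc, fun x => f x % ω ^ c, ?_⟩⟩
    · have hq : f x / ω ^ c < n := (lt_mul_iff_div_lt h0).1 ((hf x hx).1.trans hn)
      obtain ⟨m, hm⟩ := lt_omega0.1 (hq.trans (natCast_lt_omega0 n))
      rw [hm] at hq
      exact mem_iUnion.2 ⟨⟨m, by exact_mod_cast hq⟩, hx, hm⟩
    · rintro x ⟨hx, hxi⟩
      refine ⟨mod_lt _ h0, ?_⟩
      rintro y ⟨hy, hyi⟩ hxy
      have := (hf x hx).2 y hy hxy
      rw [← div_add_mod (f x) (ω ^ c), ← div_add_mod (f y) (ω ^ c), hxi, hyi] at this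
      exact lt_of_add_lt_add_left this

/-- Rank each point by the least ordinal into which its initial segment embeds. -/
theorem WOn.embeds_of_segments (h : WOn.{u} r X) {β : Ordinal.{u}}
    (hX : ∀ x ∈ X, ∃ β' < β, Embeds r {y ∈ X | r y x} β') : Embeds r X β := by
  refine ⟨fun x => sInf {o | Embeds r {y ∈ X | r y x} o}, fun x hx => ⟨?_, fun y hy hxy => ?_⟩⟩
  · obtain ⟨β', hβ', h'⟩ := hX x hx
    exact (csInf_le' (s := {o | Embeds r {y ∈ X | r y x} o}) h').trans_lt hβ'
  · obtain ⟨β', hβ', h'⟩ := hX y hy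
    obtain ⟨f, hf⟩ := csInf_mem (s := {o | Embeds r {z ∈ X | r z y} o}) ⟨β', h'⟩
    have hsub : {z ∈ X | r z x} ⊆ {z ∈ X | r z y} := fun z hz =>
      ⟨hz.1, h.trans hz.1 hx hy hz.2 hxy⟩
    have hmem : Embeds r {z ∈ X | r z x} (f x) := ?_
    · exact (csInf_le' (s := {o | Embeds r {z ∈ X | r z x} o}) hmem).trans_lt (hf x ⟨hx, hxy⟩).1
    refine ⟨f, fun z hz => ⟨?_, fun w hw => ?_⟩⟩
    · exact (hf z (hsub hz)).2 x ⟨hx, hxy⟩ hz.2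
    · exact (hf z (hsub hz)).2 w (hsub hw)

end

/-! ### Products and Hessenberg sums of exponents -/

section

variable {A B : Type*} {r : A × B → A × B → Prop} {rA : A → A → Prop} {rB : B → B → Prop}

/-- A point below `(x, y)` has a first coordinate below `x` or a second one below `y`. The
coordinates below `x` are covered by finitely many sets of exponent less than `γ`, and similarly for
`y`, so by induction every proper initial segment is a finite union of products with smaller
exponent. -/
theorem embeds_prod (γ δ : Ordinal.{u}) {X : Set A} {Y : Set B} (h : WOn.{u} r (X ×ˢ Y))
    (hA : ∀ x ∈ X, ∀ x' ∈ X, ∀ y ∈ Y, rA x x' ↔ r (x, y) (x', y))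
    (hB : ∀ x ∈ X, ∀ y ∈ Y, ∀ y' ∈ Y, rB y y' ↔ r (x, y) (x, y'))
    (hX : Embeds rA X (ω ^ γ)) (hY : Embeds rB Y (ω ^ δ)) :
    Embeds r (X ×ˢ Y) (ω ^ hsum γ δ) := by
  induction γ using WellFoundedLT.induction generalizing X Y δ with
  | ind γ ihγ =>
    induction δ using WellFoundedLT.induction generalizing X Y with
    | ind δ ihδ =>
      refine h.embeds_of_segments ?_
      rintro ⟨x, y⟩ ⟨hx, hy⟩
      dsimp only at hx hy
      have hX1 : DegLT rA {x' ∈ X | rA x' x} γ := by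
        obtain ⟨f, hf⟩ := hX
        exact ⟨f x, (hf x hx).1, f, fun z hz => ⟨(hf z hz.1).2 x hx hz.2,
          fun w hw => (hf z hz.1).2 w hw.1⟩⟩
      have hY1 : DegLT rB {y' ∈ Y | rB y' y} δ := by
        obtain ⟨f, hf⟩ := hY
        exact ⟨f y, (hf y hy).1, f, fun z hz => ⟨(hf z hz.1).2 y hy hz.2,
          fun w hw => (hf z hz.1).2 w hw.1⟩⟩
      have hX2 : DegLT r ({x' ∈ X | rA x' x} ×ˢ Y) (hsum γ δ) := by
        obtain ⟨n, Z, hZ, hZ'⟩ := hX1.exists_cover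
        refine WOn.degLT_of_subset_iUnion (Z := fun i => Z i ×ˢ Y)
          (h.mono (prod_mono_left fun z hz => hz.1)) ?_ fun i => ?_
        · rintro ⟨a, b⟩ ⟨ha, hb⟩
          obtain ⟨i, hi⟩ := mem_iUnion.1 (hZ ha)
          exact mem_iUnion.2 ⟨i, hi, hb⟩
        · obtain ⟨hsub, γ', hγ', hemb⟩ := hZ' i
          have hsub' : Z i ⊆ X := fun z hz => (hsub hz).1
          refine ⟨ω ^ hsum γ' δ, (opow_lt_opow_iff_right one_lt_omega0).2
            (hsum_lt_hsum_right hγ' δ), (ihγ γ' hγ' δ (h.mono (prod_mono_left hsub'))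
              (fun a ha a' ha' => hA a (hsub' ha) a' (hsub' ha'))
              (fun a ha => hB a (hsub' ha)) hemb hY).mono inter_subset_left le_rfl⟩
      have hY2 : DegLT r (X ×ˢ {y' ∈ Y | rB y' y}) (hsum γ δ) := by
        obtain ⟨n, Z, hZ, hZ'⟩ := hY1.exists_cover
        refine WOn.degLT_of_subset_iUnion (Z := fun i => X ×ˢ Z i)
          (h.mono (prod_mono_right fun z hz => hz.1)) ?_ fun i => ?_
        · rintro ⟨a, b⟩ ⟨ha, hb⟩
          obtain ⟨i, hi⟩ := mem_iUnion.1 (hZ hb)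
          exact mem_iUnion.2 ⟨i, ha, hi⟩
        · obtain ⟨hsub, δ', hδ', hemb⟩ := hZ' i
          have hsub' : Z i ⊆ Y := fun z hz => (hsub hz).1
          refine ⟨ω ^ hsum γ δ', (opow_lt_opow_iff_right one_lt_omega0).2
            (hsum_lt_hsum_left hδ' γ), (ihδ δ' hδ' (h.mono (prod_mono_right hsub'))
              (fun a ha a' ha' b hb => hA a ha a' ha' b (hsub' hb))
              (fun a ha b hb b' hb' => hB a ha b (hsub' hb) b' (hsub' hb')) hX hemb).mono
              inter_subset_left le_rfl⟩
      refine DegLT.mono (WOn.degLT_union (h.mono ?_) hX2 hY2) ?_ le_rfl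
      · exact union_subset (prod_mono_left fun z hz => hz.1) (prod_mono_right fun z hz => hz.1)
      · rintro ⟨a, b⟩ ⟨⟨ha, hb⟩, hab⟩
        dsimp only at ha hb
        -- If neither coordinate is smaller, then `(x, y) ≤ (x, b) ≤ (a, b)`, against `hab`.
        by_contra hnot
        have ha' : ¬ rA a x := fun h' => hnot (Or.inl ⟨⟨ha, h'⟩, hb⟩)
        have hb' : ¬ rB b y := fun h' => hnot (Or.inr ⟨ha, hb, h'⟩)
        rw [hA a ha x hx b hb] at ha'
        rw [hB x hx b hb y hy] at hb'
        have h1 : (a, b) = (x, b) ∨ r (x, b) (a, b) := by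
          by_contra! hh
          exact (h.1 (a, b) ⟨ha, hb⟩ (x, b) ⟨hx, hb⟩ hh.1).elim ha' hh.2
        have h2 : (x, b) = (x, y) ∨ r (x, y) (x, b) := by
          by_contra! hh
          exact (h.1 (x, b) ⟨hx, hb⟩ (x, y) ⟨hx, hy⟩ hh.1).elim hb' hh.2
        have m1 : (a, b) ∈ X ×ˢ Y := ⟨ha, hb⟩
        have m2 : (x, b) ∈ X ×ˢ Y := ⟨hx, hb⟩
        have m3 : (x, y) ∈ X ×ˢ Y := ⟨hx, hy⟩
        rcases h1 with h1 | h1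
        · rw [h1] at hab
          rcases h2 with h2 | h2
          · rw [h2] at hab
            exact h.asymm m3 m3 hab hab
          · exact h.asymm m3 m2 h2 hab
        · rcases h2 with h2 | h2
          · rw [h2] at h1
            exact h.asymm m3 m1 h1 hab
          · exact h.asymm m3 m1 (h.trans m3 m2 m1 h2 h1) hab

/-- The exponents of the covering pieces are at most `γ` and `δ`, and the pieces are multiplied one
pair at a time. -/
theorem degLT_prod {γ δ : Ordinal.{u}} {X : Set A} {Y : Set B} (h : WOn.{u} r (X ×ˢ Y))
    (hA : ∀ x ∈ X, ∀ x' ∈ X, ∀ y ∈ Y, rA x x' ↔ r (x, y) (x', y))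
    (hB : ∀ x ∈ X, ∀ y ∈ Y, ∀ y' ∈ Y, rB y y' ↔ r (x, y) (x, y'))
    (hX : DegLT rA X (γ + 1)) (hY : DegLT rB Y (δ + 1)) :
    DegLT r (X ×ˢ Y) (hsum γ δ + 1) := by
  obtain ⟨n, Z, hZ, hZ'⟩ := hX.exists_cover
  obtain ⟨m, W, hW, hW'⟩ := hY.exists_cover
  refine WOn.degLT_of_subset_iUnion (Z := fun p : Fin n × Fin m => Z p.1 ×ˢ W p.2) h ?_ ?_
  · rintro ⟨a, b⟩ ⟨ha, hb⟩
    obtain ⟨i, hi⟩ := mem_iUnion.1 (hZ ha)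
    obtain ⟨j, hj⟩ := mem_iUnion.1 (hW hb)
    exact mem_iUnion.2 ⟨(i, j), hi, hj⟩
  · rintro ⟨i, j⟩
    obtain ⟨hZX, γ', hγ', hZe⟩ := hZ' i
    obtain ⟨hWY, δ', hδ', hWe⟩ := hW' j
    have hle : hsum γ' δ' ≤ hsum γ δ :=
      hsum_le_hsum (Order.lt_add_one_iff.1 hγ') (Order.lt_add_one_iff.1 hδ')
    refine ⟨ω ^ hsum γ' δ', (opow_lt_opow_iff_right one_lt_omega0).2
      (Order.lt_add_one_iff.2 hle), Embeds.mono ?_ inter_subset_left le_rfl⟩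
    exact embeds_prod γ' δ' (h.mono (prod_mono hZX hWY))
      (fun a ha a' ha' b hb => hA a (hZX ha) a' (hZX ha') b (hWY hb))
      (fun a ha b hb b' hb' => hB a (hZX ha) b (hWY hb) b' (hWY hb')) hZe hWe

end

end TreeAut

namespace TreeAut

open Set

/-! ### Infinite branches and derivatives of binary trees -/

/-- The subtree of `T` at the child `b` of the root. -/
def sect (b : Bool) (T : Set (List Bool)) : Set (List Bool) :=
  {w | b :: w ∈ T}

/-- The tree whose subtree at the child `b` of the root is `P`, with no other child. -/
def shift (b : Bool) (P : Set (List Bool)) : Set (List Bool) :=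
  insert [] (List.cons b '' P)

theorem sect_shift (b : Bool) (P : Set (List Bool)) : sect b (shift b P) = P := by
  ext w; simp [sect, shift]

theorem shift_injective (b : Bool) : Function.Injective (shift b) :=
  Function.LeftInverse.injective (sect_shift b)

theorem prefixClosed_treeOf {S : Type} (K : Set (BinaryTree S)) : PrefixClosed (treeOf K) := by
  intro u v huv hv
  obtain ⟨t, ht, hvt⟩ := mem_iUnion₂.1 hv
  exact mem_iUnion₂.2 ⟨t, ht, mem_dom_of_prefix t huv hvt⟩

theorem PrefixClosed.sect {T : Set (List Bool)} (hT : PrefixClosed T) (b : Bool) :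
    PrefixClosed (sect b T) :=
  fun u v huv hv => hT (b :: u) (b :: v) (List.cons_prefix_cons.2 ⟨rfl, huv⟩) hv

theorem IsInfiniteBranch.mono {T T' P : Set (List Bool)} (h : IsInfiniteBranch T P)
    (hT : T ⊆ T') : IsInfiniteBranch T' P :=
  ⟨h.1.trans hT, h.2⟩

theorem IsInfiniteBranch.nil_mem {T P : Set (List Bool)} (h : IsInfiniteBranch T P) : [] ∈ P := by
  obtain ⟨u, hu⟩ := h.2.1.nonempty
  exact h.2.2.1 [] u List.nil_prefix hu

theorem IsInfiniteBranch.eq_shift {T P : Set (List Bool)} (h : IsInfiniteBranch T P) {b : Bool}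
    {w : List Bool} (hw : b :: w ∈ P) : P = shift b (sect b P) := by
  ext u
  rcases u with _ | ⟨c, u⟩
  · simp [h.nil_mem, shift]
  · have hc : c :: u ∈ P → c = b := fun hu => by
      rcases h.2.2.2 _ hu _ hw with h' | h'
      exacts [(List.cons_prefix_cons.1 h').1, (List.cons_prefix_cons.1 h').1.symm]
    constructor
    · intro hu
      obtain rfl := hc hu
      exact Or.inr ⟨u, hu, rfl⟩
    · rintro (h' | ⟨v, hv, hvu⟩)
      · simp at h'
      · rw [← hvu]; exact hv

theorem IsInfiniteBranch.exists_cons_mem {T P : Set (List Bool)} (h : IsInfiniteBranch T P) :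
    ∃ b w, b :: w ∈ P := by
  obtain ⟨u, hu, hne⟩ := (h.2.1.sdiff (finite_singleton [])).nonempty
  rcases u with _ | ⟨b, w⟩
  · simp at hne
  · exact ⟨b, w, hu⟩

theorem IsInfiniteBranch.sect {T P : Set (List Bool)} (h : IsInfiniteBranch T P) {b : Bool}
    {w : List Bool} (hw : b :: w ∈ P) : IsInfiniteBranch (sect b T) (sect b P) := by
  refine ⟨fun u hu => h.1 hu, fun hfin => h.2.1 ?_, h.2.2.1.sect b, fun u hu v hv => ?_⟩
  · rw [h.eq_shift hw]
    exact (hfin.image _).insert _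
  · simpa [List.cons_prefix_cons] using h.2.2.2 _ hu _ hv

theorem IsInfiniteBranch.shift {T P : Set (List Bool)} {b : Bool} (hT : PrefixClosed T)
    (h : IsInfiniteBranch (TreeAut.sect b T) P) : IsInfiniteBranch T (shift b P) := by
  have hmem : b :: [] ∈ T := h.1 h.nil_mem
  refine ⟨?_, ?_, ?_, ?_⟩
  · rintro u (rfl | ⟨v, hv, rfl⟩)
    exacts [hT _ _ List.nil_prefix hmem, h.1 hv]
  · exact (h.2.1.image (List.cons_injective.injOn)).mono (subset_insert _ _)
  · rintro u v huv (rfl | ⟨v, hv, rfl⟩)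
    · rw [List.prefix_nil.1 huv]; exact mem_insert _ _
    · rcases u with _ | ⟨c, u⟩
      · exact mem_insert _ _
      · obtain ⟨rfl, huv'⟩ := List.cons_prefix_cons.1 huv
        exact Or.inr ⟨u, h.2.2.1 u v huv' hv, rfl⟩
  · rintro u (rfl | ⟨u, hu, rfl⟩) v (rfl | ⟨v, hv, rfl⟩)
    · simp
    · simp
    · simp
    · simpa [List.cons_prefix_cons] using h.2.2.2 u hu v hv

theorem derivative_subset (T : Set (List Bool)) : derivative T ⊆ T := fun _ h => h.1

theorem derivative_mono : Monotone derivative := by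
  rintro T T' h u ⟨hu, P, Q, hPQ, hP, hQ, huP, huQ⟩
  exact ⟨h hu, P, Q, hPQ, hP.mono h, hQ.mono h, huP, huQ⟩

theorem prefixClosed_derivative (T : Set (List Bool)) : PrefixClosed (derivative T) := by
  rintro u v huv ⟨-, P, Q, hPQ, hP, hQ, hvP, hvQ⟩
  have huP := hP.2.2.1 u v huv hvP
  exact ⟨hP.1 huP, P, Q, hPQ, hP, hQ, huP, hQ.2.2.1 u v huv hvQ⟩

theorem PrefixClosed.iterate_derivative {T : Set (List Bool)} (hT : PrefixClosed T) (n : ℕ) :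
    PrefixClosed (derivative^[n] T) := by
  cases n with
  | zero => exact hT
  | succ n =>
    rw [Function.iterate_succ_apply']
    exact prefixClosed_derivative _

/-- Infinite branches through the child `b` correspond to infinite branches of the subtree there, by
`shift` and `sect`. -/
theorem derivative_sect {T : Set (List Bool)} (hT : PrefixClosed T) (b : Bool) :
    derivative (sect b T) = sect b (derivative T) := by
  ext w
  constructor
  · rintro ⟨hw, P, Q, hPQ, hP, hQ, hwP, hwQ⟩
    exact ⟨hw, shift b P, shift b Q, (shift_injective b).ne hPQ, hP.shift hT, hQ.shift hT,
      Or.inr ⟨w, hwP, rfl⟩, Or.inr ⟨w, hwQ, rfl⟩⟩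
  · rintro ⟨hw, P, Q, hPQ, hP, hQ, hwP, hwQ⟩
    refine ⟨hw, sect b P, sect b Q, fun h => hPQ ?_, hP.sect hwP, hQ.sect hwQ, hwP, hwQ⟩
    rw [hP.eq_shift hwP, hQ.eq_shift hwQ, h]

theorem iterate_derivative_sect {T : Set (List Bool)} (hT : PrefixClosed T) (b : Bool) (n : ℕ) :
    derivative^[n] (sect b T) = sect b (derivative^[n] T) := by
  induction n with
  | zero => rfl
  | succ n ih =>
    rw [Function.iterate_succ_apply', ih, derivative_sect (hT.iterate_derivative n),
      Function.iterate_succ_apply']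

theorem finite_iterate_derivative_of_le {T : Set (List Bool)} {m n : ℕ} (hmn : m ≤ n)
    (h : (derivative^[m] T).Finite) : (derivative^[n] T).Finite := by
  induction n, hmn using Nat.le_induction with
  | base => exact h
  | succ n _ ih =>
    rw [Function.iterate_succ_apply']
    exact ih.subset (derivative_subset _)

theorem cbRank_le_iff (T : Set (List Bool)) (k : ℕ) :
    cbRank T ≤ k ↔ (derivative^[k] T).Finite := by
  constructor
  · intro h
    have hne : ((fun n : ℕ => (n : ℕ∞)) '' {n : ℕ | (derivative^[n] T).Finite}).Nonempty := by
      by_contra hne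
      rw [not_nonempty_iff_eq_empty] at hne
      rw [cbRank, hne, sInf_empty] at h
      simp at h
    obtain ⟨n, hn, hn'⟩ := csInf_mem hne
    have hn'' : (n : ℕ∞) = cbRank T := hn'
    rw [← hn''] at h
    exact finite_iterate_derivative_of_le (by exact_mod_cast h) hn
  · intro h
    exact sInf_le ⟨k, h, rfl⟩

theorem isInfiniteBranch_of_seq {T : Set (List Bool)} (hT : PrefixClosed T) {f : ℕ → List Bool}
    (hinj : Function.Injective f) (hmono : ∀ m n, m ≤ n → f m <+: f n) (hf : ∀ n, f n ∈ T) :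
    IsInfiniteBranch T {u | ∃ n, u <+: f n} := by
  refine ⟨?_, ?_, ?_, ?_⟩
  · rintro u ⟨n, hn⟩
    exact hT _ _ hn (hf n)
  · refine (infinite_range_of_injective hinj).mono ?_
    rintro _ ⟨n, rfl⟩
    exact ⟨n, List.prefix_rfl⟩
  · rintro u v huv ⟨n, hn⟩
    exact ⟨n, huv.trans hn⟩
  · rintro u ⟨m, hm⟩ v ⟨n, hn⟩
    exact List.prefix_or_prefix_of_prefix (hm.trans (hmono _ _ (le_max_left m n)))
      (hn.trans (hmono _ _ (le_max_right m n)))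

/-- König's lemma: keep extending a word above which infinitely many nodes lie. -/
theorem exists_isInfiniteBranch {S : Set (List Bool)} (hS : PrefixClosed S) (hinf : S.Infinite) :
    ∃ P, IsInfiniteBranch S P := by
  have step (v : {v : List Bool // {w | v ++ w ∈ S}.Infinite}) :
      ∃ b : Bool, {w | (v.1 ++ [b]) ++ w ∈ S}.Infinite := by
    by_contra! h
    refine v.2 ((((((h false).image (List.cons false)).union
      ((h true).image (List.cons true))).insert [])).subset ?_)
    rintro (_ | ⟨_ | _, w⟩) hw
    · simp
    · exact Or.inr (Or.inl ⟨w, by simpa using hw, rfl⟩)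
    · exact Or.inr (Or.inr ⟨w, by simpa using hw, rfl⟩)
  choose next hnext using step
  let f : ℕ → {v : List Bool // {w | v ++ w ∈ S}.Infinite} := fun n =>
    Nat.rec ⟨[], by simpa using hinf⟩ (fun _ v => ⟨v.1 ++ [next v], hnext v⟩) n
  have hf (n : ℕ) : (f (n + 1)).1 = (f n).1 ++ [next (f n)] := rfl
  have hmono {m n : ℕ} (hmn : m ≤ n) : (f m).1 <+: (f n).1 := by
    induction n, hmn using Nat.le_induction with
    | base => exact List.prefix_rfl
    | succ n _ ih => rw [hf]; exact ih.trans (List.prefix_append _ _)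
  have hlen (n : ℕ) : (f n).1.length = n := by
    induction n with
    | zero => rfl
    | succ n ih => rw [hf]; simp [ih]
  refine ⟨_, isInfiniteBranch_of_seq (f := fun n => (f n).1) hS (fun m n h => ?_)
    (fun m n => hmono) fun n => ?_⟩
  · rw [← hlen m, ← hlen n]
    exact congrArg List.length h
  · obtain ⟨w, hw⟩ := (f n).2.nonempty
    exact hS _ _ (List.prefix_append _ w) hw

/-- The set of infinite branches of a tree. -/
def branches (S : Set (List Bool)) : Set (Set (List Bool)) :=
  {P | IsInfiniteBranch S P}

theorem finite_of_branches_encard_le_zero {S : Set (List Bool)} (hS : PrefixClosed S)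
    (h : (branches S).encard ≤ 0) : S.Finite := by
  by_contra hinf
  obtain ⟨P, hP⟩ := exists_isInfiniteBranch hS hinf
  rw [nonpos_iff_eq_zero, encard_eq_zero] at h
  exact (h ▸ hP : P ∈ (∅ : Set (Set (List Bool))))

/-- The shifted branches of the two sides are disjoint. This is how the budget `c` of branches is
split in `degLT_fiberSet`. -/
theorem encard_branches_sect_add_le {S : Set (List Bool)} (hS : PrefixClosed S) :
    (branches (sect false S)).encard + (branches (sect true S)).encard ≤ (branches S).encard := by
  rw [← (shift_injective false).encard_image (branches (sect false S)),
    ← (shift_injective true).encard_image (branches (sect true S)),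
    ← encard_union_eq]
  · refine encard_le_encard (union_subset ?_ ?_)
    · rintro _ ⟨P, hP, rfl⟩
      exact IsInfiniteBranch.shift hS hP
    · rintro _ ⟨P, hP, rfl⟩
      exact IsInfiniteBranch.shift hS hP
  · rw [disjoint_left]
    rintro _ ⟨P, hP, rfl⟩ ⟨Q, hQ, h⟩
    have : [true] ∈ shift false P := by
      rw [← h]
      exact Or.inr ⟨[], IsInfiniteBranch.nil_mem hQ, rfl⟩
    simp [shift] at this

/-- Beyond the length of the longest word in the derivative, every subtree has at most one infinite
branch. -/
theorem finite_branches {S : Set (List Bool)} (hS : PrefixClosed S)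
    (hfin : (derivative S).Finite) : (branches S).Finite := by
  obtain ⟨n, hn⟩ : ∃ n, ∀ u ∈ derivative S, u.length < n := by
    obtain ⟨n, hn⟩ := (hfin.image List.length).bddAbove
    exact ⟨n + 1, fun u hu => Nat.lt_succ_of_le (hn ⟨u, hu, rfl⟩)⟩
  clear hfin
  induction n generalizing S with
  | zero =>
    refine Set.Subsingleton.finite fun P hP Q hQ => ?_
    by_contra hPQ
    have h0 := IsInfiniteBranch.nil_mem hP
    exact absurd (hn [] ⟨hP.1 h0, P, Q, hPQ, hP, hQ, h0, IsInfiniteBranch.nil_mem hQ⟩) (by simp)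
  | succ n ih =>
    have key (b : Bool) : (branches (sect b S)).Finite := by
      refine ih (hS.sect b) fun u hu => ?_
      rw [derivative_sect hS] at hu
      simpa using hn _ hu
    refine (((key false).image (shift false)).union ((key true).image (shift true))).subset ?_
    intro P hP
    obtain ⟨b, w, hw⟩ := IsInfiniteBranch.exists_cons_mem hP
    have h1 := IsInfiniteBranch.sect hP hw
    have h2 := IsInfiniteBranch.eq_shift hP hw
    cases b
    · exact Or.inl ⟨_, h1, h2.symm⟩
    · exact Or.inr ⟨_, h1, h2.symm⟩

end TreeAut

namespace TreeAut

open Ordinal Set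

/-! ### Convolutions of pairs -/

theorem conv_nil_nil {S : Type} : conv ![(.nil : BinaryTree S), .nil] = .nil := by
  rw [conv, dif_pos]
  intro i
  fin_cases i <;> rfl

theorem conv_pair {S : Type} (x y : BinaryTree S) (h : ¬ (root x = none ∧ root y = none)) :
    conv ![x, y] = .node ![root x, root y] (conv ![x.left, y.left]) (conv ![x.right, y.right]) := by
  rw [conv, dif_neg]
  · congr 1
    · funext i; fin_cases i <;> rfl
    · congr 1; funext i; fin_cases i <;> rfl
    · congr 1; funext i; fin_cases i <;> rfl
  · intro h'
    have hx : x = .nil := h' 0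
    have hy : y = .nil := h' 1
    exact h (by simp [hx, hy, root])

theorem root_eq_none {S : Type} {x : BinaryTree S} : root x = none ↔ x = .nil := by
  cases x <;> simp [root]

theorem conv_injective {S : Type} {n : ℕ} :
    Function.Injective (conv : (Fin n → BinaryTree S) → BinaryTree (Fin n → Option S)) := by
  intro s t h
  funext i
  refine label_injective (funext fun u => ?_)
  have hu := congrArg (fun w => label w u) h
  simp only [label_conv] at hu
  split_ifs at hu with h1 h2 h2
  · rw [h1, h2]
  · simpa using congrFun (Option.some.inj hu) i

/-- A function on pairs of trees which is computed from the roots and the values at the children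
is called compositional. -/
def Compositional {S Q : Type} (E : BinaryTree S → BinaryTree S → Q)
    (F : Option S → Option S → Q → Q → Q) : Prop :=
  ∀ x y, E x y = F (root x) (root y) (E x.left y.left) (E x.right y.right)

theorem TreeAutomaton.exists_compositional {S : Type} (A : TreeAutomaton (Fin 2 → Option S)) :
    ∃ F, Compositional (fun x y => A.eval (conv ![x, y])) F := by
  classical
  refine ⟨fun a b q r => if a = none ∧ b = none then A.start else A.step ![a, b] q r,
    fun x y => ?_⟩
  dsimp only
  split_ifs with h
  · rw [root_eq_none.1 h.1, root_eq_none.1 h.2, conv_nil_nil]; rfl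
  · rw [conv_pair x y h]; rfl

/-! ### Bounding the order type of a set of trees -/

/-- The relation on trees given by the set `B` of values of `E`. -/
def relOf {S Q : Type} (E : BinaryTree S → BinaryTree S → Q) (B : Set Q)
    (x y : BinaryTree S) : Prop :=
  E x y ∈ B

/-- The trees which have the pair of values `e` on the diagonal and with the empty tree. -/
def diagSet {S Q : Type} (E : BinaryTree S → BinaryTree S → Q) (e : Q × Q) :
    Set (BinaryTree S) :=
  {x | E x x = e.1 ∧ E x .nil = e.2}

/-- The trees in `diagSet E e` which have the value `q` with the tree `p`. -/
def fiberSet {S Q : Type} (E : BinaryTree S → BinaryTree S → Q) (p : BinaryTree S) (q : Q)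
    (e : Q × Q) : Set (BinaryTree S) :=
  {x ∈ diagSet E e | E x p = q}

theorem exists_uniform_bound {ι O : Type*} [Finite ι] [Nonempty ι] [LinearOrder O] {δ : Set O}
    {P : ι → O → Prop} (hmono : ∀ i a b, a ≤ b → P i a → P i b) (h : ∀ i, ∃ a ∈ δ, P i a) :
    ∃ a ∈ δ, ∀ i, P i a := by
  choose f hf hP using h
  obtain ⟨i, hi⟩ := Finite.exists_max f
  exact ⟨f i, hf i, fun j => hmono j _ _ (hi j) (hP j)⟩

theorem degLT_image_node {S : Type} {r r₁ r₂ : BinaryTree S → BinaryTree S → Prop} {b : S}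
    {X Y Z : Set (BinaryTree S)} {γ δ : Ordinal.{u}} (h : WOn.{u} r Z)
    (hZ : ∀ x ∈ X, ∀ y ∈ Y, BinaryTree.node b x y ∈ Z)
    (h₁ : ∀ x ∈ X, ∀ x' ∈ X, ∀ y ∈ Y, r₁ x x' ↔ r (.node b x y) (.node b x' y))
    (h₂ : ∀ x ∈ X, ∀ y ∈ Y, ∀ y' ∈ Y, r₂ y y' ↔ r (.node b x y) (.node b x y'))
    (hX : DegLT r₁ X (γ + 1)) (hY : DegLT r₂ Y (δ + 1)) :
    DegLT r (image2 (BinaryTree.node b) X Y) (hsum γ δ + 1) := by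
  let s : BinaryTree S × BinaryTree S → BinaryTree S × BinaryTree S → Prop :=
    fun u v => r (.node b u.1 u.2) (.node b v.1 v.2)
  have hs : WOn.{u} s (X ×ˢ Y) := by
    refine h.comap (fun u => .node b u.1 u.2) ?_ (fun u hu => hZ _ hu.1 _ hu.2)
      fun _ _ _ _ => Iff.rfl
    rintro ⟨x, y⟩ ⟨x', y'⟩ hxy
    simpa using hxy
  refine (degLT_prod hs h₁ h₂ hX hY).comap (fun x => (x.left, x.right)) ?_ ?_
  · rintro _ ⟨x, hx, y, hy, rfl⟩
    exact ⟨hx, hy⟩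
  · rintro _ ⟨x, hx, y, hy, rfl⟩ _ ⟨x', hx', y', hy', rfl⟩ hr
    exact hr

theorem dom_left_subset {S : Type} {b : S} {l r : BinaryTree S} {T : Set (List Bool)}
    (h : dom (.node b l r) ⊆ T) : dom l ⊆ sect false T :=
  fun u hu => h (show label (.node b l r) (false :: u) ≠ none from hu)

theorem dom_right_subset {S : Type} {b : S} {l r : BinaryTree S} {T : Set (List Bool)}
    (h : dom (.node b l r) ⊆ T) : dom r ⊆ sect true T :=
  fun u hu => h (show label (.node b l r) (true :: u) ≠ none from hu)

/-- Every well-order on a set `diagSet E e` of trees with domains in `T`, given by a set of values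
of `E`, has an order type below `ω ^ ω ^ j`, provided that the `j`-th derivative of `T` is
finite. -/
def DiagBound {S Q : Type} (E : BinaryTree S → BinaryTree S → Q) (j : ℕ) : Prop :=
  ∀ (e : Q × Q) (B : Set Q) (T : Set (List Bool)), PrefixClosed T →
    (derivative^[j] T).Finite → (∀ x ∈ diagSet E e, dom x ⊆ T) →
    WOn.{u} (relOf E B) (diagSet E e) →
    ∃ ε < (ω : Ordinal.{u}) ^ (j : Ordinal.{u}), DegLT (relOf E B) (diagSet E e) (ε + 1)

section

variable {S Q : Type} {E : BinaryTree S → BinaryTree S → Q}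
  {F : Option S → Option S → Q → Q → Q}

theorem degLT_one_of_finite {A : Type*} {r : A → A → Prop} {X : Set A} (hX : X.Finite)
    (h : WOn.{u} r X) : DegLT r X (1 : Ordinal.{u}) := by
  have := hX.to_subtype
  refine h.degLT_of_subset_iUnion (Z := fun x : X => {x.1}) (fun x hx => ?_) fun x => ?_
  · exact mem_iUnion.2 ⟨⟨x, hx⟩, rfl⟩
  · refine ⟨1, by simp, fun _ => 0, ?_⟩
    rintro y ⟨rfl, hy⟩
    refine ⟨zero_lt_one, ?_⟩
    rintro z ⟨rfl, hz⟩ hyz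
    exact absurd hyz (h.asymm hz hz hyz)

theorem finite_setOf_dom_subset [Finite S] {T : Set (List Bool)} (hT : T.Finite) :
    {x : BinaryTree S | dom x ⊆ T}.Finite := by
  have := hT.to_subtype
  refine Set.Finite.of_finite_image (f := fun x (u : T) => label x u) (toFinite _) ?_
  intro x hx y hy hxy
  refine label_injective (funext fun u => ?_)
  by_cases hu : u ∈ T
  · exact congrFun hxy ⟨u, hu⟩
  · have h1 : label x u = none := not_not.1 fun h => hu (hx h)
    have h2 : label y u = none := not_not.1 fun h => hu (hy h)
    rw [h1, h2]

theorem diagBound_zero [Finite S] : DiagBound.{u} E 0 := by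
  intro e B T _ hfin hdom hwo
  refine ⟨0, by simp, ?_⟩
  rw [zero_add]
  exact degLT_one_of_finite ((finite_setOf_dom_subset hfin).subset hdom) hwo

/-- Induction on `p`: the degrees over the two subtrees add up by the Hessenberg sum, the
coefficients of `ω ^ j` by `c₁ + c₂ ≤ c`, and the remainders stay below `ω ^ j`. The a priori bound
`hdeg` passes to the factors, since they embed as slices; it is what makes `hN` applicable at the
ends. -/
theorem degLT_fiberSet [Finite S] [Finite Q] (hE : Compositional E F) {j N : ℕ}
    (hj : DiagBound.{u} E j)
    (hN : ∀ (e : Q × Q) (B : Set Q), (∃ γ < (ω : Ordinal.{u}) ^ ((j + 1 : ℕ) : Ordinal.{u}),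
      DegLT (relOf E B) (diagSet E e) γ) →
      DegLT (relOf E B) (diagSet E e) ((ω : Ordinal.{u}) ^ (j : Ordinal.{u}) * N + 1))
    (p : BinaryTree S) (q : Q) (e : Q × Q) (B : Set Q) {T : Set (List Bool)} (c : ℕ)
    (hT : PrefixClosed T) (hc : (branches (derivative^[j] T)).encard ≤ c)
    (hdom : ∀ x ∈ fiberSet E p q e, dom x ⊆ T) (hwo : WOn.{u} (relOf E B) (fiberSet E p q e))
    (hdeg : ∃ γ < (ω : Ordinal.{u}) ^ ((j + 1 : ℕ) : Ordinal.{u}),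
      DegLT (relOf E B) (fiberSet E p q e) γ) :
    ∃ ε < (ω : Ordinal.{u}) ^ (j : Ordinal.{u}), DegLT (relOf E B) (fiberSet E p q e)
      (ω ^ (j : Ordinal.{u}) * (c * N : ℕ) + ε + 1) := by
  have hpos : (0 : Ordinal.{u}) < ω ^ (j : Ordinal.{u}) := opow_pos _ omega0_pos
  induction p generalizing q e B T c with
  | nil =>
    by_cases hq : e.2 = q
    · have hfib : fiberSet E .nil q e = diagSet E e := by
        ext x
        exact ⟨fun h => h.1, fun h => ⟨h, h.2.trans hq⟩⟩
      rw [hfib] at hdom hwo hdeg ⊢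
      -- Without a branch the `j`-th derivative is finite and the induction hypothesis applies; with
      -- at least one, the budget pays for the uniform bound `N`.
      rcases Nat.eq_zero_or_pos c with rfl | hc0
      · obtain ⟨ε, hε, h⟩ := hj e B T hT
          (finite_of_branches_encard_le_zero (hT.iterate_derivative j) (by simpa using hc)) hdom hwo
        exact ⟨ε, hε, by simpa using h⟩
      · refine ⟨0, hpos, (hN e B hdeg).mono subset_rfl ?_⟩
        rw [add_zero]
        gcongr
        exact Nat.le_mul_of_pos_left N hc0
    · have hfib : fiberSet E .nil q e = ∅ := by
        ext x
        simp only [mem_empty_iff_false, iff_false]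
        exact fun h => hq (h.1.2.symm.trans h.2)
      rw [hfib]
      exact ⟨0, hpos, degLT_empty _⟩
  | node a pl pr ihl ihr =>
    -- A piece fixes the root label and, on each side, the state with the subtree of `p`, the
    -- diagonal state and the state with the empty tree; `none` stands for the empty tree.
    let Z : Option (S × (Q × Q × Q) × (Q × Q × Q)) → Set (BinaryTree S) := fun i =>
      i.elim {.nil} fun i => image2 (BinaryTree.node i.1)
        (fiberSet E pl i.2.1.1 i.2.1.2) (fiberSet E pr i.2.2.1 i.2.2.2)
    suffices h : ∀ i, ∃ ε ∈ Iio ((ω : Ordinal.{u}) ^ (j : Ordinal.{u})),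
        DegLT (relOf E B) (Z i ∩ fiberSet E (.node a pl pr) q e)
          (ω ^ (j : Ordinal.{u}) * (c * N : ℕ) + ε + 1) by
      obtain ⟨ε, hε, h⟩ := exists_uniform_bound
        (fun i a b hab h => h.mono subset_rfl (by gcongr)) h
      refine ⟨ε, hε, hwo.degLT_of_subset_iUnion (fun x hx => ?_) h⟩
      refine mem_iUnion.2 ?_
      rcases x with _ | ⟨b, l, r⟩
      · exact ⟨none, rfl⟩
      · exact ⟨some (b, (E l pl, E l l, E l .nil), (E r pr, E r r, E r .nil)),
          l, ⟨⟨rfl, rfl⟩, rfl⟩, r, ⟨⟨rfl, rfl⟩, rfl⟩, rfl⟩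
    rintro (_ | ⟨b, ⟨q₁, e₁⟩, ⟨q₂, e₂⟩⟩)
    · refine ⟨0, hpos, (degLT_one_of_finite ((finite_singleton _).inter_of_left _)
        (hwo.mono inter_subset_right)).mono subset_rfl ?_⟩
      exact le_add_self
    · rcases (Z (some (b, (q₁, e₁), (q₂, e₂))) ∩ fiberSet E (.node a pl pr) q e).eq_empty_or_nonempty
        with h0 | ⟨_, ⟨l₀, hl₀, r₀, hr₀, rfl⟩, h0⟩
      · rw [h0]
        exact ⟨0, hpos, degLT_empty _⟩
      dsimp only at hl₀ hr₀ h0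
      have hnode (b : S) (l r : BinaryTree S) (b' : S) (l' r' : BinaryTree S) :
          E (.node b l r) (.node b' l' r') = F (some b) (some b') (E l l') (E r r') := hE _ _
      have hnode' (b : S) (l r : BinaryTree S) :
          E (.node b l r) .nil = F (some b) none (E l .nil) (E r .nil) := hE _ _
      -- All data entering the transition are constant on the piece, so one member `node b l₀ r₀`
      -- brings the whole product into the fibre.
      have hsub : ∀ l ∈ fiberSet E pl q₁ e₁, ∀ r ∈ fiberSet E pr q₂ e₂,
          BinaryTree.node b l r ∈ fiberSet E (.node a pl pr) q e := by
        intro l hl r hr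
        obtain ⟨⟨h1, h2⟩, h3⟩ := h0
        rw [hnode] at h1 h3
        rw [hnode'] at h2
        refine ⟨⟨?_, ?_⟩, ?_⟩
        · rw [← h1, hnode, hl.1.1, hl₀.1.1, hr.1.1, hr₀.1.1]
        · rw [← h2, hnode', hl.1.2, hl₀.1.2, hr.1.2, hr₀.1.2]
        · rw [← h3, hnode, hl.2, hl₀.2, hr.2, hr₀.2]
      -- When only the left subtree varies, the right one is paired with itself and contributes the
      -- constant diagonal state `e₂.1`. Hence the slice order is again given by a set of states.
      let B₁ : Set Q := {s | F (some b) (some b) s e₂.1 ∈ B}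
      let B₂ : Set Q := {s | F (some b) (some b) e₁.1 s ∈ B}
      have hB₁ : ∀ l l', ∀ r ∈ fiberSet E pr q₂ e₂, relOf E B₁ l l' ↔
          relOf E B (.node b l r) (.node b l' r) := by
        intro l l' r hr
        simp only [relOf, hnode, hr.1.1]
        rfl
      have hB₂ : ∀ l ∈ fiberSet E pl q₁ e₁, ∀ r r', relOf E B₂ r r' ↔
          relOf E B (.node b l r) (.node b l r') := by
        intro l hl r r'
        simp only [relOf, hnode, hl.1.1]
        rfl
      have hbr := (encard_branches_sect_add_le (hT.iterate_derivative j)).trans hc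
      rw [← iterate_derivative_sect hT, ← iterate_derivative_sect hT] at hbr
      obtain ⟨c₁, hc₁⟩ := ENat.ne_top_iff_exists.1
        (ne_top_of_le_ne_top (ENat.natCast_ne_top c) (le_self_add.trans hbr))
      obtain ⟨c₂, hc₂⟩ := ENat.ne_top_iff_exists.1
        (ne_top_of_le_ne_top (ENat.natCast_ne_top c) (le_add_self.trans hbr))
      rw [← hc₁, ← hc₂] at hbr
      have hcc : c₁ + c₂ ≤ c := by exact_mod_cast hbr
      obtain ⟨γ, hγ, hdeg⟩ := hdeg
      obtain ⟨ε₁, hε₁, h₁⟩ := ihl q₁ e₁ B₁ c₁ (hT.sect false) hc₁.ge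
        (fun l hl => dom_left_subset (hdom _ (hsub l hl r₀ hr₀)))
        (hwo.comap (fun l => .node b l r₀) (fun l l' h => by simpa using h)
          (fun l hl => hsub l hl r₀ hr₀) fun l _ l' _ => hB₁ l l' r₀ hr₀)
        ⟨γ, hγ, hdeg.comap (fun l => .node b l r₀)
          (fun l hl => hsub l hl r₀ hr₀) fun l _ l' _ => (hB₁ l l' r₀ hr₀).1⟩
      obtain ⟨ε₂, hε₂, h₂⟩ := ihr q₂ e₂ B₂ c₂ (hT.sect true) hc₂.ge
        (fun r hr => dom_right_subset (hdom _ (hsub l₀ hl₀ r hr)))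
        (hwo.comap (fun r => .node b l₀ r) (fun r r' h => by simpa using h)
          (fun r hr => hsub l₀ hl₀ r hr) fun r _ r' _ => hB₂ l₀ hl₀ r r')
        ⟨γ, hγ, hdeg.comap (fun r => .node b l₀ r)
          (fun r hr => hsub l₀ hl₀ r hr) fun r _ r' _ => (hB₂ l₀ hl₀ r r').1⟩
      refine ⟨hsum ε₁ ε₂, hsum_lt_opow _ hε₁ hε₂,
        (degLT_image_node hwo hsub (fun l _ l' _ r hr => hB₁ l l' r hr)
          (fun l hl r _ r' _ => hB₂ l hl r r') h₁ h₂).mono inter_subset_left ?_⟩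
      gcongr
      refine (hsum_add_le (fun _ _ => hsum_lt_opow _) _ _ hε₁ hε₂).trans ?_
      gcongr
      rw [← add_mul]
      exact Nat.mul_le_mul_right N hcc

/-- Only finitely many pairs `(e, B)` exist, and each ordinal below `ω ^ (j + 1)` is below some `ω ^
j * n`. -/
theorem exists_uniform_degree [Finite Q] (E : BinaryTree S → BinaryTree S → Q) (j : ℕ) :
    ∃ N : ℕ, ∀ (e : Q × Q) (B : Set Q),
      (∃ γ < (ω : Ordinal.{u}) ^ ((j + 1 : ℕ) : Ordinal.{u}),
        DegLT (relOf E B) (diagSet E e) γ) →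
      DegLT (relOf E B) (diagSet E e) ((ω : Ordinal.{u}) ^ (j : Ordinal.{u}) * N + 1) := by
  rcases isEmpty_or_nonempty Q with hQ | hQ
  · exact ⟨0, fun e => isEmptyElim e.1⟩
  obtain ⟨N, -, hN⟩ := exists_uniform_bound (ι := (Q × Q) × Set Q) (δ := (univ : Set ℕ))
    (P := fun i N => (∃ γ < (ω : Ordinal.{u}) ^ ((j + 1 : ℕ) : Ordinal.{u}),
        DegLT (relOf E i.2) (diagSet E i.1) γ) →
      DegLT (relOf E i.2) (diagSet E i.1) ((ω : Ordinal.{u}) ^ (j : Ordinal.{u}) * N + 1))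
    (fun i a b hab h hγ => (h hγ).mono subset_rfl (by gcongr)) fun i => by
      by_cases h : ∃ γ < (ω : Ordinal.{u}) ^ ((j + 1 : ℕ) : Ordinal.{u}),
        DegLT (relOf E i.2) (diagSet E i.1) γ
      · obtain ⟨γ, hγ, h⟩ := h
        push_cast at hγ
        obtain ⟨n, hn⟩ := lt_omega0_opow_succ.1 hγ
        exact ⟨n, mem_univ _, fun _ => h.mono subset_rfl (hn.le.trans le_self_add)⟩
      · exact ⟨0, mem_univ _, fun h' => absurd h' h⟩
  exact ⟨N, fun e B => hN (e, B)⟩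

theorem DiagBound.succ [Finite S] [Finite Q] (hE : Compositional E F) {j : ℕ} (hj : DiagBound.{u} E j) :
    DiagBound.{u} E (j + 1) := by
  intro e B T hT hfin hdom hwo
  obtain ⟨N, hN⟩ := exists_uniform_degree.{u} E j
  rw [Function.iterate_succ_apply'] at hfin
  have hbr := finite_branches (hT.iterate_derivative j) hfin
  obtain ⟨c, hc⟩ := ENat.ne_top_iff_exists.1 hbr.encard_lt_top.ne
  -- The extra `1` in the coefficient absorbs the term `ε + 1 ≤ ω ^ j`.
  let G : Ordinal.{u} := ω ^ (j : Ordinal.{u}) * (c * N + 1 : ℕ)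
  have hG : G < ω ^ ((j + 1 : ℕ) : Ordinal.{u}) :=
    opow_mul_lt_opow (natCast_lt_omega0 _) (by simp)
  have hG' : G + 1 < ω ^ ((j + 1 : ℕ) : Ordinal.{u}) :=
    isPrincipal_add_omega0_opow _ hG (one_lt_opow.2 ⟨one_lt_omega0, by simp⟩)
  -- The gap: any degree bound below `ω ^ (j + 1)` improves to `G`.
  have step : ∀ p ∈ diagSet E e, (∃ γ < (ω : Ordinal.{u}) ^ ((j + 1 : ℕ) : Ordinal.{u}),
      DegLT (relOf E B) {x ∈ diagSet E e | relOf E B x p} γ) →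
      DegLT (relOf E B) {x ∈ diagSet E e | relOf E B x p} G := by
    rintro p hp ⟨γ, hγ, hdeg⟩
    have hwo' := hwo.mono (sep_subset (diagSet E e) fun x => relOf E B x p)
    refine hwo'.degLT_of_subset_iUnion (Z := fun q : B => fiberSet E p q e)
      (fun x hx => mem_iUnion.2 ⟨⟨_, hx.2⟩, hx.1, rfl⟩) ?_
    rintro ⟨q, hq⟩
    have hsub : fiberSet E p q e ⊆ {x ∈ diagSet E e | relOf E B x p} :=
      fun x hx => ⟨hx.1, show E x p ∈ B from hx.2 ▸ hq⟩
    obtain ⟨ε, hε, h⟩ := degLT_fiberSet hE hj hN p q e B c hT hc.ge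
      (fun x hx => hdom x hx.1) (hwo'.mono hsub) ⟨γ, hγ, hdeg.mono hsub le_rfl⟩
    refine h.mono inter_subset_left ?_
    simp only [G]
    rw [add_assoc, Nat.cast_add_one, mul_add_one]
    gcongr
    exact Order.add_one_le_of_lt hε
  have seg : ∀ p ∈ diagSet E e, DegLT (relOf E B) {x ∈ diagSet E e | relOf E B x p} G := by
    obtain ⟨-, β, f, hf⟩ := id hwo
    intro p hp
    induction hn : f p using WellFoundedLT.induction generalizing p with
    | ind o ih =>
      subst hn
      -- The segments of all predecessors embed below `ω ^ G`, so this one embeds into `ω ^ G`; that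
      -- costs one in the exponent, which `step` wins back.
      refine step p hp ⟨G + 1, hG', ω ^ G, (opow_lt_opow_iff_right one_lt_omega0).2
        (Order.lt_add_one_iff.2 le_rfl), ?_⟩
      refine (hwo.mono (sep_subset _ _)).embeds_of_segments fun x hx => ?_
      obtain ⟨β', hβ', h⟩ := ih (f x) ((hf x hx.1).2 p hp hx.2) x hx.1 rfl
      exact ⟨β', hβ', h.mono (fun y hy => ⟨hy.1.1, hy.2⟩) le_rfl⟩
  exact ⟨G, hG, ω ^ G, (opow_lt_opow_iff_right one_lt_omega0).2 (Order.lt_add_one_iff.2 le_rfl),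
    hwo.embeds_of_segments seg⟩

theorem diagBound [Finite S] [Finite Q] (hE : Compositional E F) (j : ℕ) : DiagBound.{u} E j := by
  induction j with
  | zero => exact diagBound_zero
  | succ j ih => exact ih.succ hE

/-! ### The upper bound for presented ordinals -/

theorem le_of_strictMono_toType {α β : Ordinal.{u}} {g : α.ToType → Ordinal.{u}}
    (hg : StrictMono g) (hβ : ∀ a, g a < β) : α ≤ β := by
  have key (x : Ordinal.{u}) (hx : x < α) : x ≤ g (ToType.mk ⟨x, hx⟩) := by
    induction x using WellFoundedLT.induction with
    | ind x ih =>
      refine le_of_forall_lt fun y hy => (ih y hy (hy.trans hx)).trans_lt (hg ?_)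
      exact ToType.mk.lt_iff_lt.2 hy
  by_contra! h
  exact (key β h).not_gt (hβ _)

theorem embeds_range {A : Type*} {r : A → A → Prop} {α : Ordinal.{u}} {μ : α.ToType → A}
    (hμ : Function.Injective μ) (hr : ∀ a b, r (μ a) (μ b) → a < b) :
    Embeds r (range μ) α := by
  refine ⟨Function.extend μ (fun a => (ToType.toOrd a).1) 0, ?_⟩
  rintro _ ⟨a, rfl⟩
  rw [hμ.extend_apply]
  refine ⟨(ToType.toOrd a).2, ?_⟩
  rintro _ ⟨b, rfl⟩ hab
  rw [hμ.extend_apply]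
  exact ToType.mk.symm.lt_iff_lt.2 (hr a b hab)

theorem lt_opow_opow_of_presents [Finite S] {P : Presentation FirstOrder.Language.order S}
    {α : Ordinal.{u}} (hP : P.Presents α.ToType) {k : ℕ} (hk : P.rank ≤ k) :
    α < ω ^ (ω : Ordinal.{u}) ^ (k : Ordinal.{u}) := by
  obtain ⟨μ, hμ, hrel⟩ := hP
  let A := P.rel FirstOrder.Language.orderRel.le
  have := A.finite_state
  obtain ⟨F, hF⟩ := A.exists_compositional
  -- With swapped arguments, rejection of the pair says that `y ≤ x` fails, so the complement of the
  -- accepting set defines the strict order.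
  let E : BinaryTree S → BinaryTree S → A.State := fun x y => A.eval (conv ![y, x])
  have hE : Compositional E fun a b => F b a := fun x y => hF y x
  have hmem (x y : BinaryTree S) : A.eval (conv ![x, y]) ∈ A.accept ↔
      ∃ a b : α.ToType, a ≤ b ∧ μ a = x ∧ μ b = y := by
    have h := hrel 2 FirstOrder.Language.orderRel.le
    rw [Recognises] at h
    have h1 : A.eval (conv ![x, y]) ∈ A.accept ↔ conv ![x, y] ∈ A.language := Iff.rfl
    rw [h1, show A.language = _ from h, conv_injective.mem_set_image]
    constructor
    · rintro ⟨z, hz, hz'⟩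
      exact ⟨z 0, z 1, hz, congrFun hz' 0, congrFun hz' 1⟩
    · rintro ⟨a, b, hab, rfl, rfl⟩
      refine ⟨![a, b], hab, ?_⟩
      funext i; fin_cases i <;> rfl
  have hinj : Function.Injective μ := fun a b h => hμ.injOn (mem_univ _) (mem_univ _) h
  have hlt (a b : α.ToType) : relOf E A.acceptᶜ (μ a) (μ b) ↔ a < b := by
    have : relOf E A.acceptᶜ (μ a) (μ b) ↔ ¬ A.eval (conv ![μ b, μ a]) ∈ A.accept := Iff.rfl
    rw [this, hmem, ← not_le, not_iff_not]
    constructor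
    · rintro ⟨c, d, hcd, hc, hd⟩
      rwa [hinj hc, hinj hd] at hcd
    · exact fun h => ⟨b, a, h, rfl, rfl⟩
  have hrange : range μ = P.univ.language := by
    rw [← image_univ]; exact hμ.image_eq
  have hT := prefixClosed_treeOf P.univ.language
  have hwo : WOn.{u} (relOf E A.acceptᶜ) (range μ) := by
    refine ⟨?_, α, embeds_range hinj fun a b => (hlt a b).1⟩
    rintro _ ⟨a, rfl⟩ _ ⟨b, rfl⟩ hab
    rw [hlt, hlt]
    exact lt_or_gt_of_ne (ne_of_apply_ne μ hab)
  have hdeg : DegLT (relOf E A.acceptᶜ) (range μ) ((ω : Ordinal.{u}) ^ (k : Ordinal.{u})) := by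
    -- By reflexivity, names are exactly the trees whose diagonal state accepts, so the universe is
    -- a finite union of diagonal sets.
    refine hwo.degLT_of_subset_iUnion
      (Z := fun e : {e : A.State × A.State // e.1 ∈ A.accept} => diagSet E e.1) ?_ ?_
    · rintro _ ⟨a, rfl⟩
      exact mem_iUnion.2 ⟨⟨(E (μ a) (μ a), E (μ a) .nil), (hmem _ _).2 ⟨a, a, le_rfl, rfl, rfl⟩⟩,
        rfl, rfl⟩
    · rintro ⟨e, he⟩
      have hsub : diagSet E e ⊆ range μ := by
        rintro x ⟨hx, -⟩
        obtain ⟨a, -, -, ha, -⟩ := (hmem x x).1 (show E x x ∈ A.accept from hx ▸ he)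
        exact ⟨a, ha⟩
      obtain ⟨ε, hε, h⟩ := diagBound.{u} hE k e A.acceptᶜ _ hT ((cbRank_le_iff _ _).1 hk)
        (fun x hx => subset_biUnion_of_mem (u := dom) (hrange ▸ hsub hx)) (hwo.mono hsub)
      exact h.mono inter_subset_left (Order.add_one_le_of_lt hε)
  obtain ⟨β, hβ, f, hf⟩ := hdeg
  refine (le_of_strictMono_toType (g := f ∘ μ) (fun a b hab => ?_) fun a => ?_).trans_lt hβ
  · exact (hf _ ⟨a, rfl⟩).2 _ ⟨b, rfl⟩ ((hlt a b).2 hab)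
  · exact (hf _ ⟨a, rfl⟩).1

end

end TreeAut

/-! ### Freeness from finite rank, and trees with few left turns -/

namespace TreeAut

open Set

/-- The images of `u 0 0 0 …` and `u 1 0 0 …` generate two distinct infinite branches through `f u`.
Thus an embedded full binary tree survives every derivative. -/
theorem mem_derivative_of_embedding {T : Set (List Bool)} (hT : PrefixClosed T)
    {f : List Bool → List Bool} (hinj : Function.Injective f) (hf : ∀ u, f u ∈ T)
    (hpre : ∀ u v : List Bool, u <+: v ↔ f u <+: f v) (u : List Bool) : f u ∈ derivative T := by
  have hbr (b : Bool) :
      IsInfiniteBranch T {w | ∃ n, w <+: f (u ++ b :: List.replicate n false)} := by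
    refine isInfiniteBranch_of_seq hT (fun m n h => ?_) (fun m n hmn => ?_) fun n => hf _
    · simpa using congrArg List.length (hinj h)
    · rw [← hpre, List.prefix_append_right_inj, List.cons_prefix_cons]
      refine ⟨rfl, ?_⟩
      obtain ⟨d, rfl⟩ := Nat.exists_eq_add_of_le hmn
      rw [List.replicate_add]
      exact List.prefix_append _ _
  refine ⟨hf u, _, _, fun h => ?_, hbr false, hbr true, ⟨0, ?_⟩, ⟨0, ?_⟩⟩
  · have h1 : f (u ++ [true]) ∈ {w | ∃ n, w <+: f (u ++ true :: List.replicate n false)} :=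
      ⟨0, List.prefix_rfl⟩
    rw [← h] at h1
    obtain ⟨n, hn⟩ := h1
    rw [← hpre, List.prefix_append_right_inj, List.cons_prefix_cons] at hn
    simp at hn
  · exact (hpre _ _).1 (List.prefix_append _ _)
  · exact (hpre _ _).1 (List.prefix_append _ _)

theorem tbinFree_of_finite {T : Set (List Bool)} (hT : PrefixClosed T) {n : ℕ}
    (h : (derivative^[n] T).Finite) : TbinFree T := by
  rintro ⟨f, hinj, hf, hpre⟩
  have key (m : ℕ) (u : List Bool) : f u ∈ derivative^[m] T := by
    induction m generalizing u with
    | zero => exact hf u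
    | succ m ih =>
      rw [Function.iterate_succ_apply']
      exact mem_derivative_of_embedding (hT.iterate_derivative m) hinj ih hpre u
  exact infinite_of_injective_forall_mem hinj (key n) h

/-- The words with at most `k` zeros which begin with fewer than `m` ones. -/
def combTree (m k : ℕ) : Set (List Bool) :=
  {w | w.count false ≤ k ∧ ¬ List.replicate m true <+: w}

theorem IsInfiniteBranch.eq_of_subset {T P : Set (List Bool)} (hP : IsInfiniteBranch T P)
    {f : ℕ → List Bool} (hmono : ∀ m n, m ≤ n → f m <+: f n)
    (hPf : P ⊆ {u | ∃ n, u <+: f n}) : P = {u | ∃ n, u <+: f n} := by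
  refine hPf.antisymm ?_
  rintro w ⟨n, hn⟩
  obtain ⟨v, hv, hvw⟩ : ∃ v ∈ P, w.length < v.length := by
    by_contra! h
    exact hP.2.1 ((List.finite_length_le Bool w.length).subset h)
  obtain ⟨m, hm⟩ := hPf hv
  refine hP.2.2.1 w v (List.prefix_of_prefix_length_le (hn.trans (hmono _ _ (le_max_left n m)))
    (hm.trans (hmono _ _ (le_max_right n m))) hvw.le) hv

/-- A node that has used all its zeros can only be continued by ones, so it lies on at most one
infinite branch. -/
theorem derivative_combTree_subset (m k : ℕ) : derivative (combTree m (k + 1)) ⊆ combTree m k := by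
  rintro u ⟨hu, P, Q, hPQ, hP, hQ, huP, huQ⟩
  refine ⟨?_, hu.2⟩
  by_contra! hk
  have key {P : Set (List Bool)} (hP : IsInfiniteBranch (combTree m (k + 1)) P) (huP : u ∈ P) :
      P = {w | ∃ n, w <+: u ++ List.replicate n true} := by
    refine hP.eq_of_subset (fun a b hab => ?_) fun v hv => ?_
    · rw [List.prefix_append_right_inj]
      obtain ⟨d, rfl⟩ := Nat.exists_eq_add_of_le hab
      rw [List.replicate_add]
      exact List.prefix_append _ _
    · rcases hP.2.2.2 v hv u huP with h | ⟨t, rfl⟩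
      · exact ⟨0, by simpa using h⟩
      · have h1 := (hP.1 hv).1
        rw [List.count_append] at h1
        have h2 : t.count false = 0 := by omega
        refine ⟨t.length, ?_⟩
        rw [← List.eq_replicate_of_mem (l := t) (a := true)]
        intro b hb
        cases b
        · exact absurd hb (List.count_eq_zero.1 h2)
        · rfl
  exact hPQ ((key hP huP).trans (key hQ huQ).symm)

theorem finite_combTree_zero (m : ℕ) : (combTree m 0).Finite := by
  refine ((finite_Iio m).image fun n => List.replicate n true).subset ?_
  rintro w ⟨h1, h2⟩
  have hw : w = List.replicate w.length true := by
    refine List.eq_replicate_of_mem fun b hb => ?_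
    cases b
    · exact absurd hb (List.count_eq_zero.1 (Nat.le_zero.1 h1))
    · rfl
  refine ⟨w.length, ?_, hw.symm⟩
  by_contra! h
  apply h2
  rw [hw]
  obtain ⟨d, hd⟩ := Nat.exists_eq_add_of_le (not_lt.1 h)
  rw [hd, List.replicate_add]
  exact List.prefix_append _ _

theorem finite_iterate_derivative_combTree (m k : ℕ) :
    (derivative^[k] (combTree m k)).Finite := by
  induction k with
  | zero => exact finite_combTree_zero m
  | succ k ih =>
    rw [Function.iterate_succ_apply]
    exact ih.subset (derivative_mono.iterate k (derivative_combTree_subset m k))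

end TreeAut

namespace TreeAut

open Ordinal Set

/-! ### Automata from congruences -/

/-- The states are the values of `h`, and a transition is computed on chosen representatives; states
that are not attained are irrelevant. -/
theorem exists_automaton_of_congr {S K : Type} [Finite K] (h : BinaryTree S → K)
    (hcongr : ∀ a l r l' r', h l = h l' → h r = h r' → h (.node a l r) = h (.node a l' r'))
    (C : Set K) : ∃ A : TreeAutomaton S, A.language = {t | h t ∈ C} := by
  classical
  let step : S → K → K → K := fun a p q =>
    if hpq : ∃ l r, h l = p ∧ h r = q then h (.node a hpq.choose hpq.choose_spec.choose)
    else h .nil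
  let A : TreeAutomaton S := ⟨K, inferInstance, h .nil, step, C⟩
  have hA (t : BinaryTree S) : A.eval t = h t := by
    induction t with
    | nil => rfl
    | node a l r hl hr =>
      have : ∃ l' r', h l' = h l ∧ h r' = h r := ⟨l, r, rfl, rfl⟩
      have h1 : A.eval (.node a l r) = step a (A.eval l) (A.eval r) := rfl
      rw [h1, hl, hr]
      simp only [step]
      rw [dif_pos this]
      exact hcongr a _ _ _ _ this.choose_spec.choose_spec.1 this.choose_spec.choose_spec.2
  refine ⟨A, ?_⟩
  ext t
  exact iff_of_eq (congrArg (· ∈ C) (hA t))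

theorem exists_recognises_of_congr {S Q : Type} [Finite Q] (E : BinaryTree S → BinaryTree S → Q)
    (hE : ∀ x y x' y', root x = root x' → root y = root y' → E x.left y.left = E x'.left y'.left →
      E x.right y.right = E x'.right y'.right → E x y = E x' y') (C : Set Q) :
    ∃ A : TreeAutomaton (Fin 2 → Option S), Recognises A {t | E (t 0) (t 1) ∈ C} := by
  -- The set is empty when `w` is not a convolution. The two flags record which component is empty,
  -- because a component padded at the root must have empty children.
  let h : BinaryTree (Fin 2 → Option S) → Set (Q × Prop × Prop) := fun w =>
    {s | ∃ x y, w = conv ![x, y] ∧ s = (E x y, x = .nil, y = .nil)}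
  have hsub : ∀ a l r l' r', h l = h l' → h r = h r' → h (.node a l r) ⊆ h (.node a l' r') := by
    rintro a l r l' r' hl hr s ⟨x, y, hw, rfl⟩
    by_cases hxy : root x = none ∧ root y = none
    · rw [root_eq_none.1 hxy.1, root_eq_none.1 hxy.2, conv_nil_nil] at hw
      exact absurd hw (by simp)
    rw [conv_pair x y hxy, BinaryTree.node.injEq] at hw
    obtain ⟨rfl, hwl, hwr⟩ := hw
    have h1 : (E x.left y.left, x.left = .nil, y.left = .nil) ∈ h l := ⟨_, _, hwl, rfl⟩
    have h2 : (E x.right y.right, x.right = .nil, y.right = .nil) ∈ h r := ⟨_, _, hwr, rfl⟩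
    rw [hl] at h1
    rw [hr] at h2
    obtain ⟨xl, yl, rfl, hl'⟩ := h1
    obtain ⟨xr, yr, rfl, hr'⟩ := h2
    simp only [Prod.mk.injEq, eq_iff_iff] at hl' hr'
    have build (z zl zr : BinaryTree S) (h1 : z.left = .nil ↔ zl = .nil)
        (h2 : z.right = .nil ↔ zr = .nil) : ∃ z' : BinaryTree S, root z = root z' ∧
        z'.left = zl ∧ z'.right = zr := by
      cases z with
      | nil => exact ⟨.nil, rfl, (h1.1 rfl).symm, (h2.1 rfl).symm⟩
      | node a _ _ => exact ⟨.node a zl zr, rfl, rfl, rfl⟩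
    obtain ⟨x', hx', rfl, rfl⟩ := build x xl xr hl'.2.1 hr'.2.1
    obtain ⟨y', hy', rfl, rfl⟩ := build y yl yr hl'.2.2 hr'.2.2
    refine ⟨x', y', ?_, ?_⟩
    · rw [hx', hy', conv_pair x' y']
      rwa [← hx', ← hy']
    · rw [hE x y x' y' hx' hy' hl'.1 hr'.1, ← root_eq_none, ← root_eq_none, hx', hy',
        root_eq_none, root_eq_none]
  obtain ⟨A, hA⟩ := exists_automaton_of_congr h
    (fun a l r l' r' hl hr => (hsub a l r l' r' hl hr).antisymm (hsub a l' r' l r hl.symm hr.symm))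
    {s | ∃ q ∈ C, ∃ p, (q, p) ∈ s}
  refine ⟨A, ?_⟩
  rw [Recognises, hA]
  ext w
  constructor
  · rintro ⟨q, hq, p, x, y, rfl, h⟩
    rw [Prod.mk.injEq] at h
    exact ⟨![x, y], show E x y ∈ C from h.1 ▸ hq, rfl⟩
  · rintro ⟨t, ht, rfl⟩
    refine ⟨E (t 0) (t 1), ht, _, t 0, t 1, ?_, rfl⟩
    congr 1
    funext i; fin_cases i <;> rfl

/-! ### A well-order on unlabelled trees -/

/-- The comparison of unlabelled trees: the empty tree is the least one, and other trees are
compared at their right subtrees first, and then at their left subtrees. -/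
def cmpTree : BinaryTree Unit → BinaryTree Unit → Ordering
  | .nil, .nil => .eq
  | .nil, .node _ _ _ => .lt
  | .node _ _ _, .nil => .gt
  | .node _ l r, .node _ l' r' => (cmpTree r r').then (cmpTree l l')

/-- Every path from the root of the tree turns left fewer than `k` times. -/
def LeftDepthLT : BinaryTree Unit → ℕ → Prop
  | .nil, _ => True
  | .node _ _ _, 0 => False
  | .node _ l r, k + 1 => LeftDepthLT l k ∧ LeftDepthLT r (k + 1)

/-- A bound for the values of the trees with `LeftDepthLT x k`. -/
noncomputable def base : ℕ → Ordinal.{u}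
  | 0 => 1
  | k + 1 => ω ^ (ω : Ordinal.{u}) ^ (k : Ordinal.{u})

/-- An ordinal which determines the position of a tree with `LeftDepthLT x k`. -/
noncomputable def val : BinaryTree Unit → ℕ → Ordinal.{u}
  | .nil, _ => 0
  | .node _ _ _, 0 => 0
  | .node _ l r, k + 1 => base k * (val r (k + 1) + 1) + val l k

theorem base_pos (k : ℕ) : (0 : Ordinal.{u}) < base k := by
  cases k with
  | zero => exact zero_lt_one
  | succ k => exact opow_pos _ omega0_pos

theorem base_lt_base_succ (k : ℕ) : (base k : Ordinal.{u}) < base (k + 1) := by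
  cases k with
  | zero => simp [base, one_lt_omega0]
  | succ k =>
    refine (opow_lt_opow_iff_right one_lt_omega0).2 ((opow_lt_opow_iff_right one_lt_omega0).2 ?_)
    exact_mod_cast Nat.lt_succ_self k

/-- The right subtree dominates: a larger `a` outweighs any remainder below `base k`. -/
theorem base_mul_add_lt {k : ℕ} {a b a' b' : Ordinal.{u}} (ha : a < a') (hb : b < base k) :
    base k * (a + 1) + b < base k * (a' + 1) + b' :=
  calc base k * (a + 1) + b < base k * (a + 1) + base k := by gcongr
    _ = base k * (a + 1 + 1) := (mul_add_one _ _).symm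
    _ ≤ base k * (a' + 1) := by gcongr; exact Order.add_one_le_of_lt ha
    _ ≤ _ := le_self_add

/-- `base (k + 1)` has the form `ω ^ ω ^ k`, hence is closed under addition and multiplication. -/
theorem val_lt_base {x : BinaryTree Unit} {k : ℕ} (h : LeftDepthLT x k) :
    (val x k : Ordinal.{u}) < base k := by
  induction x generalizing k with
  | nil => exact base_pos k
  | node a l r hl hr =>
    cases k with
    | zero => exact h.elim
    | succ k =>
      have h1 : (1 : Ordinal.{u}) < base (k + 1) :=
        (Order.one_le_iff_pos.2 (base_pos k)).trans_lt (base_lt_base_succ k)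
      have hadd := isPrincipal_add_omega0_opow ((ω : Ordinal.{u}) ^ (k : Ordinal.{u}))
      exact hadd (isPrincipal_mul_omega0_opow_opow _ (base_lt_base_succ k) (hadd (hr h.2) h1))
        ((hl h.1).trans (base_lt_base_succ k))

theorem cmpTree_eq_compare {x y : BinaryTree Unit} {k : ℕ} (hx : LeftDepthLT x k)
    (hy : LeftDepthLT y k) : cmpTree x y = compare (val x k : Ordinal.{u}) (val y k) := by
  induction x generalizing y k with
  | nil =>
    cases y with
    | nil => exact (compare_eq_iff_eq.2 rfl).symm
    | node b l' r' =>
      cases k with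
      | zero => exact hy.elim
      | succ k =>
        refine (compare_lt_iff_lt.2 (lt_of_lt_of_le (b := base k * (val r' (k + 1) + 1)) ?_ ?_)).symm
        · exact mul_pos (base_pos k) (by simp)
        · exact le_self_add
  | node a l r hl hr =>
    cases k with
    | zero => exact hx.elim
    | succ k =>
      cases y with
      | nil =>
        refine (compare_gt_iff_gt.2 (lt_of_lt_of_le (b := base k * (val r (k + 1) + 1)) ?_ ?_)).symm
        · exact mul_pos (base_pos k) (by simp)
        · exact le_self_add
      | node b l' r' =>
        rw [cmpTree, hl hx.1 hy.1, hr hx.2 hy.2, val, val]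
        rcases lt_trichotomy (val r (k + 1) : Ordinal.{u}) (val r' (k + 1)) with h | h | h
        · rw [compare_lt_iff_lt.2 h, compare_lt_iff_lt.2 (base_mul_add_lt h (val_lt_base hx.1))]
          rfl
        · rw [h, compare_eq_iff_eq.2 rfl]
          simp only [Ordering.eq_then]
          rcases lt_trichotomy (val l k : Ordinal.{u}) (val l' k) with h' | h' | h'
          · rw [compare_lt_iff_lt.2 h', compare_lt_iff_lt.2 (by gcongr)]
          · rw [h', compare_eq_iff_eq.2 rfl, compare_eq_iff_eq.2 rfl]
          · rw [compare_gt_iff_gt.2 h', compare_gt_iff_gt.2 (by gcongr)]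
        · rw [compare_gt_iff_gt.2 h, compare_gt_iff_gt.2 (base_mul_add_lt h (val_lt_base hy.1))]
          rfl

theorem eq_of_cmpTree_eq {x y : BinaryTree Unit} (h : cmpTree x y = .eq) : x = y := by
  induction x generalizing y with
  | nil => cases y <;> simp_all [cmpTree]
  | node a l r hl hr =>
    cases y with
    | nil => simp [cmpTree] at h
    | node b l' r' =>
      rw [cmpTree, Ordering.then_eq_eq] at h
      rw [hl h.2, hr h.1]

theorem cmpTree_self (x : BinaryTree Unit) : cmpTree x x = .eq := by
  induction x with
  | nil => rfl
  | node a l r hl hr => rw [cmpTree, hl, hr]; rfl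

theorem val_injOn (k : ℕ) :
    InjOn (fun x => (val x k : Ordinal.{u})) {x | LeftDepthLT x k} := by
  intro x hx y hy hxy
  exact eq_of_cmpTree_eq ((cmpTree_eq_compare.{u} hx hy).trans (compare_eq_iff_eq.2 hxy))

/-- The tree which lists the digits of an ordinal in base `ρ`, the least significant one first,
where digits are represented by trees. -/
noncomputable def digitTree (ρ : Ordinal.{u}) (g : Ordinal.{u} → BinaryTree Unit)
    (ξ : Ordinal.{u}) : BinaryTree Unit :=
  open Classical in
  if _h : ξ / ρ < ξ then .node () (g (ξ % ρ)) (digitTree ρ g (ξ / ρ)) else .nil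
termination_by ξ

/-- Otherwise `ρ * ξ ≤ ξ`, which forces `ρ ^ ω` to divide `ξ`. This lets the digit recursion reach
zero. -/
theorem div_lt_self_of_lt {ρ ξ : Ordinal.{u}} (hρ : 0 < ρ) (hξ : ξ ≠ 0) (h : ξ < ρ ^ (ω : Ordinal.{u})) :
    ξ / ρ < ξ := by
  by_contra! h1
  have h2 : ρ * ξ ≤ ξ := (mul_le_mul_right h1 ρ).trans (mul_div_le ξ ρ)
  exact (le_of_dvd hξ ((mul_le_right_iff_opow_omega0_dvd hρ).1 h2)).not_gt h

/-- For `k = 0`, finite ordinals become right spines. Next, `base (k + 2) = base (k + 1) ^ ω`, so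
digits in base `base (k + 1)`, coded by the previous `g`, hang to the left of a right spine; the
comparison looks at the quotient before the last digit. -/
theorem exists_strictMono_tree (k : ℕ) : ∃ g : Ordinal.{u} → BinaryTree Unit,
    ∀ ξ < base (k + 1), LeftDepthLT (g ξ) (k + 1) ∧ ∀ ξ' < ξ, cmpTree (g ξ') (g ξ) = .lt := by
  induction k with
  | zero =>
    let chain : ℕ → BinaryTree Unit := fun n => Nat.rec .nil (fun _ t => .node () .nil t) n
    have h1 (n : ℕ) : LeftDepthLT (chain n) 1 := by
      induction n with
      | zero => trivial
      | succ n ih => exact ⟨trivial, ih⟩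
    have h2 (m n : ℕ) (h : m < n) : cmpTree (chain m) (chain n) = .lt := by
      induction n generalizing m with
      | zero => omega
      | succ n ih =>
        cases m with
        | zero => rfl
        | succ m =>
          have := ih m (by omega)
          change (cmpTree (chain m) (chain n)).then (cmpTree .nil .nil) = .lt
          rw [this]; rfl
    refine ⟨fun ξ => chain (Cardinal.toNat ξ.card), fun ξ hξ => ⟨h1 _, fun ξ' hξ' => h2 _ _ ?_⟩⟩
    have hξω : ξ < ω := by simpa [base] using hξ
    obtain ⟨n, rfl⟩ := lt_omega0.1 hξω
    obtain ⟨m, rfl⟩ := lt_omega0.1 (hξ'.trans hξω)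
    simpa using hξ'
  | succ k ih =>
    obtain ⟨g, hg⟩ := ih
    let ρ : Ordinal.{u} := base (k + 1)
    have hρ : 0 < ρ := base_pos _
    have hpow : base (k + 1 + 1) = ρ ^ (ω : Ordinal.{u}) := by
      simp only [ρ, base]
      rw [← opow_mul, ← opow_add_one]
      simp
    refine ⟨digitTree ρ g, fun ξ => ?_⟩
    induction ξ using WellFoundedLT.induction with
    | ind ξ ihξ =>
      intro hξ
      rcases eq_or_ne ξ 0 with rfl | hξ0
      · rw [digitTree, dif_neg (by simp)]
        exact ⟨trivial, fun ξ' h => absurd h not_lt_zero⟩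
      have hlt := div_lt_self_of_lt hρ hξ0 (hpow ▸ hξ)
      obtain ⟨i1, i2⟩ := ihξ _ hlt (hlt.trans hξ)
      obtain ⟨j1, j2⟩ := hg (ξ % ρ) (mod_lt ξ hρ.ne')
      rw [digitTree, dif_pos hlt]
      refine ⟨⟨j1, i1⟩, fun ξ' hξ' => ?_⟩
      rw [digitTree]
      split_ifs with h'
      · rw [cmpTree]
        rcases (Ordinal.div_le_left hξ'.le ρ).lt_or_eq with h | h
        · rw [i2 _ h]; rfl
        · rw [h, cmpTree_self, Ordering.eq_then]
          refine j2 _ ?_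
          rw [← div_add_mod ξ ρ, ← div_add_mod ξ' ρ, h] at hξ'
          exact lt_of_add_lt_add_left hξ'
      · rfl

/-- Enumerate the trees by their values. The strictly monotone `g` shows that the enumeration does
not stop before `base (k + 1)`, so there is an `α`-th tree `p`, preceded by exactly `α` trees. -/
theorem exists_bijOn_tree {α : Ordinal.{u}} {k : ℕ} (hα : α < base (k + 1)) :
    ∃ (p : BinaryTree Unit) (μ : α.ToType → BinaryTree Unit),
      BijOn μ univ {x | LeftDepthLT x (k + 1) ∧ cmpTree x p = .lt} ∧
      ∀ a b, a ≤ b ↔ cmpTree (μ a) (μ b) ≠ .gt := by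
  obtain ⟨g, hg⟩ := exists_strictMono_tree.{u} k
  -- The tail `Ici` only makes the set unbounded, as `enumOrd` requires; `hle` shows that it is not
  -- reached below `base (k + 1)`.
  let s : Set Ordinal.{u} := (fun x => val x (k + 1)) '' {x | LeftDepthLT x (k + 1)} ∪
    Ici (base (k + 1))
  have hs : ¬ BddAbove s := fun h => not_bddAbove_Ici _ (h.mono subset_union_right)
  have hle (ξ : Ordinal.{u}) (hξ : ξ < base (k + 1)) : enumOrd s ξ ≤ val (g ξ) (k + 1) := by
    induction ξ using WellFoundedLT.induction with
    | ind ξ ih =>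
      refine enumOrd_le_of_forall_lt (Or.inl ⟨_, (hg ξ hξ).1, rfl⟩) fun b hb => ?_
      refine (ih b hb (hb.trans hξ)).trans_lt ?_
      rw [← compare_lt_iff_lt, ← cmpTree_eq_compare (hg b (hb.trans hξ)).1 (hg ξ hξ).1]
      exact (hg ξ hξ).2 b hb
  have hmem (ξ : Ordinal.{u}) : ∃ x, ξ < base (k + 1) →
      LeftDepthLT x (k + 1) ∧ val x (k + 1) = enumOrd s ξ := by
    by_cases hξ : ξ < base (k + 1)
    · rcases enumOrd_mem hs ξ with ⟨x, hx, h⟩ | h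
      · exact ⟨x, fun _ => ⟨hx, h⟩⟩
      · exact absurd ((hle ξ hξ).trans_lt (val_lt_base (hg ξ hξ).1)) (not_lt.2 h)
    · exact ⟨.nil, fun h => absurd h hξ⟩
  choose t ht using hmem
  have hcmp (ξ η : Ordinal.{u}) (hξ : ξ < base (k + 1)) (hη : η < base (k + 1)) :
      cmpTree (t ξ) (t η) = compare ξ η := by
    rw [cmpTree_eq_compare (ht ξ hξ).1 (ht η hη).1, (ht ξ hξ).2, (ht η hη).2]
    rw [← cmp_eq_compare, ← cmp_eq_compare, (enumOrd_strictMono hs).cmp_map_eq]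
  have hord (a : α.ToType) : (ToType.toOrd a).1 < α := (ToType.toOrd a).2
  refine ⟨t α, fun a => t (ToType.toOrd a).1, ⟨fun a _ => ⟨(ht _ ((hord a).trans hα)).1, ?_⟩,
    fun a _ b _ hab => ?_, ?_⟩, fun a b => ?_⟩
  · rw [hcmp _ _ ((hord a).trans hα) hα]
    exact compare_lt_iff_lt.2 (hord a)
  · have h := hcmp _ _ ((hord a).trans hα) ((hord b).trans hα)
    dsimp only at hab
    rw [hab, cmpTree_self] at h
    exact ToType.mk.symm.injective (Subtype.ext (compare_eq_iff_eq.1 h.symm))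
  · rintro x ⟨hx, hxp⟩
    obtain ⟨ξ, hξ⟩ := enumOrd_surjective hs (b := val x (k + 1)) (Or.inl ⟨x, hx, rfl⟩)
    rw [cmpTree_eq_compare.{u} hx (ht α hα).1, (ht α hα).2, ← hξ, compare_lt_iff_lt,
      enumOrd_lt_enumOrd hs] at hxp
    refine ⟨ToType.mk ⟨ξ, hxp⟩, mem_univ _, ?_⟩
    obtain ⟨h1, h2⟩ := ht ξ (hxp.trans hα)
    simpa using val_injOn (k + 1) h1 hx (h2.trans hξ)
  · dsimp only
    rw [hcmp _ _ ((hord a).trans hα) ((hord b).trans hα), Ne, compare_gt_iff_gt, not_lt]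
    exact ToType.mk.symm.le_iff_le.symm

end TreeAut

namespace TreeAut

open Ordinal Set

/-! ### The presentations -/

/-- The set of all subtrees of a tree, including the empty tree. -/
def subtrees {S : Type*} : BinaryTree S → Set (BinaryTree S)
  | .nil => {.nil}
  | .node a l r => insert (.node a l r) (subtrees l ∪ subtrees r)

theorem mem_subtrees_self {S : Type*} (t : BinaryTree S) : t ∈ subtrees t := by
  cases t with
  | nil => exact mem_singleton _
  | node a l r => exact mem_insert _ _

theorem finite_subtrees {S : Type*} (t : BinaryTree S) : (subtrees t).Finite := by
  induction t with
  | nil => exact finite_singleton _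
  | node a l r hl hr => exact (hl.union hr).insert _

theorem mem_subtrees_of_node_mem {S : Type*} {t l r : BinaryTree S} {a : S}
    (h : .node a l r ∈ subtrees t) : l ∈ subtrees t ∧ r ∈ subtrees t := by
  induction t with
  | nil => simp [subtrees] at h
  | node b l' r' hl hr =>
    rcases h with h | h | h
    · rw [BinaryTree.node.injEq] at h
      obtain ⟨rfl, rfl, rfl⟩ := h
      exact ⟨Or.inr (Or.inl (mem_subtrees_self _)), Or.inr (Or.inr (mem_subtrees_self _))⟩
    · exact ⟨Or.inr (Or.inl (hl h).1), Or.inr (Or.inl (hl h).2)⟩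
    · exact ⟨Or.inr (Or.inr (hr h).1), Or.inr (Or.inr (hr h).2)⟩

instance finite_ordering : Finite Ordering :=
  .of_injective (fun o => (o == .lt, o == .eq)) (by
    rintro (_ | _ | _) (_ | _ | _) h <;> simp_all)

/-- The finite information about a tree from which its left depth below `k` and its position
relative to the subtrees of `p` can be read off. -/
def profile (p : BinaryTree Unit) (k : ℕ) (x : BinaryTree Unit) :
    (Fin (k + 1) → Prop) × (subtrees p → Ordering) :=
  (fun i => LeftDepthLT x i, fun q => cmpTree x q)

/-- Comparing a node with a subtree of `p` only needs comparisons of its children with smaller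
subtrees of `p`, so finitely many comparisons determine each other bottom-up. -/
theorem profile_congr (p : BinaryTree Unit) (k : ℕ) {a : Unit} {l r l' r' : BinaryTree Unit}
    (hl : profile p k l = profile p k l') (hr : profile p k r = profile p k r') :
    profile p k (.node a l r) = profile p k (.node a l' r') := by
  simp only [profile, Prod.mk.injEq] at hl hr
  refine Prod.ext (funext fun i => ?_) (funext fun q => ?_)
  · obtain ⟨i, hi⟩ := i
    cases i with
    | zero => rfl
    | succ i =>
      have h1 : LeftDepthLT l i = LeftDepthLT l' i := congrFun hl.1 ⟨i, by omega⟩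
      have h2 : LeftDepthLT r (i + 1) = LeftDepthLT r' (i + 1) := congrFun hr.1 ⟨i + 1, hi⟩
      simp only [profile, LeftDepthLT, h1, h2]
  · obtain ⟨q, hq⟩ := q
    cases q with
    | nil => rfl
    | node b ql qr =>
      have h1 : cmpTree l ql = cmpTree l' ql := congrFun hl.2 ⟨ql, (mem_subtrees_of_node_mem hq).1⟩
      have h2 : cmpTree r qr = cmpTree r' qr := congrFun hr.2 ⟨qr, (mem_subtrees_of_node_mem hq).2⟩
      simp only [profile, cmpTree, h1, h2]

/-- The values of `profile` of the trees of left depth below `k` which precede `p`. -/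
def initialProfiles (p : BinaryTree Unit) (k : ℕ) :
    Set ((Fin (k + 1) → Prop) × (subtrees p → Ordering)) :=
  {s | s.1 (Fin.last k) ∧ s.2 ⟨p, mem_subtrees_self p⟩ = .lt}

theorem exists_automaton_initial (p : BinaryTree Unit) (k : ℕ) : ∃ A : TreeAutomaton Unit,
    A.language = {x | LeftDepthLT x k ∧ cmpTree x p = .lt} := by
  have := (finite_subtrees p).to_subtype
  exact exists_automaton_of_congr (profile p k) (fun _ _ _ _ _ => profile_congr p k)
    (initialProfiles p k)

theorem exists_recognises_initial_le (p : BinaryTree Unit) (k : ℕ) :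
    ∃ A : TreeAutomaton (Fin 2 → Option Unit),
      Recognises A {t | (LeftDepthLT (t 0) k ∧ cmpTree (t 0) p = .lt) ∧
        (LeftDepthLT (t 1) k ∧ cmpTree (t 1) p = .lt) ∧ cmpTree (t 0) (t 1) ≠ .gt} := by
  have := (finite_subtrees p).to_subtype
  refine exists_recognises_of_congr
    (fun x y => (profile p k x, profile p k y, cmpTree x y)) ?_
    {s | s.1 ∈ initialProfiles p k ∧ s.2.1 ∈ initialProfiles p k ∧ s.2.2 ≠ .gt}
  have hprof (x x' : BinaryTree Unit) (h : root x = root x')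
      (hl : profile p k x.left = profile p k x'.left)
      (hr : profile p k x.right = profile p k x'.right) : profile p k x = profile p k x' := by
    cases x <;> cases x' <;> simp only [root, reduceCtorEq] at h
    · rfl
    · exact profile_congr p k hl hr
  intro x y x' y' hx hy hl hr
  simp only [Prod.mk.injEq] at hl hr ⊢
  refine ⟨hprof x x' hx hl.1 hr.1, hprof y y' hy hl.2.1 hr.2.1, ?_⟩
  cases x <;> cases x' <;> cases y <;> cases y' <;> simp only [root, reduceCtorEq] at hx hy
  · rfl
  · rfl
  · rfl
  · exact congrArg₂ Ordering.then hr.2.2 hl.2.2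

theorem count_false_le_of_mem_dom {x : BinaryTree Unit} {k : ℕ} (h : LeftDepthLT x (k + 1))
    {u : List Bool} (hu : u ∈ dom x) : u.count false ≤ k := by
  induction x generalizing k u with
  | nil => exact absurd rfl hu
  | node a l r hl hr =>
    rcases u with _ | ⟨_ | _, u⟩
    · simp
    · have hu' : u ∈ dom l := hu
      cases k with
      | zero =>
        cases l with
        | nil => exact absurd rfl hu'
        | node b l' r' => exact h.1.elim
      | succ k => simpa using hl h.1 hu'
    · simpa using hr h.2 (show u ∈ dom r from hu)

/-- Right subtrees are compared first, so a tree with a longer rightmost path is greater. This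
bounds the initial ones and saves one derivative. -/
theorem replicate_mem_dom_of_cmpTree {x p : BinaryTree Unit} (h : cmpTree x p ≠ .gt) {m : ℕ}
    (hx : List.replicate m true ∈ dom x) : List.replicate m true ∈ dom p := by
  induction m generalizing x p with
  | zero =>
    cases x with
    | nil => exact absurd rfl hx
    | node a l r =>
      cases p with
      | nil => exact absurd rfl h
      | node b l' r' => simp [dom, label]
  | succ m ih =>
    cases x with
    | nil => exact absurd rfl hx
    | node a l r =>
      cases p with
      | nil => exact absurd rfl h
      | node b l' r' =>
        refine ih (x := r) (p := r') (fun h' => h ?_) hx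
        rw [cmpTree, h']; rfl

theorem exists_treeOf_initial_subset (p : BinaryTree Unit) (k : ℕ) :
    ∃ m, treeOf {x | LeftDepthLT x (k + 1) ∧ cmpTree x p = .lt} ⊆ combTree m k := by
  obtain ⟨m, hm⟩ : ∃ m, List.replicate m true ∉ dom p := by
    by_contra! h
    exact infinite_of_injective_forall_mem
      (fun a b hab => by simpa using congrArg List.length hab) h (finite_dom p)
  refine ⟨m, fun u hu => ?_⟩
  obtain ⟨x, ⟨hx, hxp⟩, hux⟩ := mem_iUnion₂.1 hu
  refine ⟨count_false_le_of_mem_dom hx hux, fun h => hm ?_⟩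
  exact replicate_mem_dom_of_cmpTree (by rw [hxp]; simp) (mem_dom_of_prefix x h hux)

theorem exists_presentation {α : Ordinal.{u}} {k : ℕ}
    (hα : α < ω ^ (ω : Ordinal.{u}) ^ (k : Ordinal.{u})) :
    ∃ P : Presentation FirstOrder.Language.order Unit,
      P.Presents α.ToType ∧ P.IsTbinFree ∧ P.rank ≤ (k : ℕ∞) := by
  obtain ⟨p, μ, hμ, hle⟩ := exists_bijOn_tree (k := k) hα
  obtain ⟨A, hA⟩ := exists_automaton_initial p (k + 1)
  obtain ⟨B, hB⟩ := exists_recognises_initial_le p (k + 1)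
  obtain ⟨m, hm⟩ := exists_treeOf_initial_subset p k
  rw [← hA] at hm hμ
  have hfin : (derivative^[k] (treeOf A.language)).Finite :=
    (finite_iterate_derivative_combTree m k).subset (derivative_mono.iterate k hm)
  have hT := prefixClosed_treeOf A.language
  let rel : ∀ {n : ℕ}, FirstOrder.Language.order.Relations n →
      TreeAutomaton (Fin n → Option Unit) := fun {n} R => match n, R with
    | 2, .le => B
  refine ⟨⟨A, rel⟩, ⟨μ, hμ, ?_⟩, tbinFree_of_finite hT hfin, (cbRank_le_iff _ _).2 hfin⟩
  rintro _ ⟨⟩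
  have hset : {t : Fin 2 → BinaryTree Unit | (LeftDepthLT (t 0) (k + 1) ∧ cmpTree (t 0) p = .lt) ∧
      (LeftDepthLT (t 1) (k + 1) ∧ cmpTree (t 1) p = .lt) ∧ cmpTree (t 0) (t 1) ≠ .gt} =
      (fun (x : Fin 2 → α.ToType) (i : Fin 2) => μ (x i)) ''
        {x | FirstOrder.Language.Structure.RelMap (L := FirstOrder.Language.order)
          FirstOrder.Language.orderRel.le x} := by
    rw [hA] at hμ
    ext t
    constructor
    · rintro ⟨h0, h1, h01⟩
      obtain ⟨a, -, ha⟩ := hμ.surjOn h0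
      obtain ⟨b, -, hb⟩ := hμ.surjOn h1
      refine ⟨![a, b], ?_, ?_⟩
      · rw [← ha, ← hb, ← hle] at h01
        exact h01
      · funext i; fin_cases i
        exacts [ha, hb]
    · rintro ⟨x, hx, rfl⟩
      exact ⟨hμ.mapsTo (mem_univ _), hμ.mapsTo (mem_univ _), (hle _ _).1 hx⟩
  rw [← hset]
  exact hB

end TreeAut

theorem mainTheorem3 (α : Ordinal.{u}) (k : ℕ) :
    (∃ (S : Type) (_ : Finite S) (P : TreeAut.Presentation FirstOrder.Language.order S),
      P.Presents α.ToType ∧ P.IsTbinFree ∧ P.rank ≤ (k : ℕ∞)) ↔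
    α < Ordinal.omega0 ^ (Ordinal.omega0 ^ (k : Ordinal.{u})) := by
  constructor
  · rintro ⟨S, _, P, hP, -, hk⟩
    exact TreeAut.lt_opow_opow_of_presents hP hk
  · intro h
    exact ⟨Unit, inferInstance, TreeAut.exists_presentation h⟩
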